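/- Let $H$ be an infinite-dimensional separable complex Hilbert space with inner product $(\cdot,\cdot)$ and norm $\|\cdot\|$. Let $\mathbf a[\cdot,\cdot]$ be a closed Hermitian sesquilinear form with domain $H^1$ dense in $H$, positive in the sense that $\mathbf a[u,u]\ge c\|u\|^2$ for all $u\in H^1$ and some $c>0$; regard $H^1$ as a Hilbert space with inner product $\mathbf a[\cdot,\cdot]$. Let $H_0^1$ be a closed subspace of $H^1$ which is dense in $H$. Let $A_N$ and $A_D$ be the self-adjoint operators in $H$ generated by $\mathbf a$ and by the restriction of $\mathbf a$ to $H_0^1$, respectively. Let $H^1_A$ be the set of $u\in H^1$ for which the functional $v\mapsto \mathbf a[u,v]$ on $H_0^1$ is continuous in the norm of $H$, and let $A:H^1_A\to H$ be defined by $(Au,v)=\mathbf a[u,v]$ for all $v\in H_0^1$. For $\mu\in\mathbb R$ put $G_\mu=\{u\in H^1_A: Au=\mu u\}$, a closed subspace of $H^1$, let $\Pi'_\mu$ be the $H^1$-orthogonal projection onto $G_\mu$, and let $$\mathcal B_\mu=(I-\mu\,\Pi'_\mu A_N^{-1})|_{G_\mu},$$ a bounded self-adjoint operator in the Hilbert space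 $G_\mu$ with inner product $\mathbf a[\cdot,\cdot]$; equivalently $\mathbf a[\mathcal B_\mu u,v]=\mathbf a[u,v]-\mu(u,v)$ for $u,v\in G_\mu$. For $B\in\{N,D\}$ let $E_B(\mu)$ be the orthogonal projection in $H$ onto $\ker(A_B-\mu I)$. Let $\mathcal H_0$ be the closed subspace of $H$ spanned by all common eigenvectors of $A_N$ and $A_D$, let $\mathcal H$ be its orthogonal complement in $H$, and put $n_{N,D}(\mu)=\dim E_B(\mu)\mathcal H_0$ (which is the same for $B=N$ and $B=D$) and $n_B(\mu)=\dim E_B(\mu)\mathcal H$. Let $\lambda\in\mathbb R$ with $\lambda\notin\sigma_{\mathrm{ess}}(A_N)\cup\sigma_{\mathrm{ess}}(A_D)$. Then there is $\varepsilon_0>0$ such that for every $\varepsilon\in(0,\varepsilon_0)$ there is $\delta>0$ for which the following holds, eigenvalues being counted according to their multiplicities. 1. $\sigma(\mathcal B_\lambda)\cap(-\varepsilon,\varepsilon)$ consists of exactly $n_N(\lambda)+n_D(\lambda)+n_{N,D}(\lambda)$ eigenvalues, all equal to zero. 2. For every $\mu\in(\lambda-\delta,\lambda)$, $\sigma(\mathcal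 B_\mu)\cap(-\varepsilon,\varepsilon)$ consists of exactly $n_D(\lambda)$ negative and $n_N(\lambda)$ positive eigenvalues (in particular $0\notin\sigma(\mathcal B_\mu)$). 3. For every $\mu\in(\lambda,\lambda+\delta)$, $\sigma(\mathcal B_\mu)\cap(-\varepsilon,\varepsilon)$ consists of exactly $n_N(\lambda)$ negative and $n_D(\lambda)$ positive eigenvalues (in particular $0\notin\sigma(\mathcal B_\mu)$). -/

import Mathlib

open Filter Topology

noncomputable section

/-- A densely defined, closed, positive definite Hermitian form on a complex Hilbert space.
The form is conjugate-linear in the first variable, as are Mathlib's inner products. -/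
structure ClosedPositiveForm (H : Type*) [NormedAddCommGroup H] [InnerProductSpace ℂ H] where
  /-- the form domain `H¹` -/
  domain : Submodule ℂ H
  dense_domain : Dense (domain : Set H)
  /-- the sesquilinear form `a[·,·]` -/
  form : domain →ₗ⋆[ℂ] domain →ₗ[ℂ] ℂ
  symm : ∀ u v, starRingEnd ℂ (form u v) = form v u
  positive : ∃ c : ℝ, 0 < c ∧ ∀ u : domain, c * ‖(u : H)‖ ^ 2 ≤ (form u u).re
  closed : ∀ (u : ℕ → domain) (x : H), Tendsto (fun n => (u n : H)) atTop (𝓝 x) →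
    (∀ ε : ℝ, 0 < ε → ∃ N, ∀ m, N ≤ m → ∀ n, N ≤ n →
      (form (u m - u n) (u m - u n)).re < ε) →
    ∃ y : domain, (y : H) = x ∧
      Tendsto (fun n => (form (u n - y) (u n - y)).re) atTop (𝓝 0)

namespace ClosedPositiveForm

variable {H : Type*} [NormedAddCommGroup H] [InnerProductSpace ℂ H]

/-- `H¹` regarded as a Hilbert space with the inner product `a[·,·]`. -/
def Space (a : ClosedPositiveForm H) : Type _ := a.domain

instance (a : ClosedPositiveForm H) : AddCommGroup a.Space :=
  inferInstanceAs (AddCommGroup a.domain)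

instance (a : ClosedPositiveForm H) : Module ℂ a.Space :=
  inferInstanceAs (Module ℂ a.domain)

/-- The inner product `a[·,·]` on `H¹`. -/
@[reducible]
def core (a : ClosedPositiveForm H) : InnerProductSpace.Core ℂ a.Space where
  inner u v := a.form u v
  conj_inner_symm u v := a.symm v u
  re_inner_nonneg u := by
    obtain ⟨c, hc, h⟩ := a.positive
    exact le_trans (by positivity) (h u)
  add_left u v w := LinearMap.map_add₂ a.form u v w
  smul_left u v r := LinearMap.map_smulₛₗ₂ a.form r u v
  definite u hu := by
    obtain ⟨c, hc, h⟩ := a.positive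
    have h1 := h u
    have h2 : (a.form u u).re = 0 := by
      have := congrArg Complex.re hu
      simpa using this
    rw [h2] at h1
    have h3 : ‖((show a.domain from u) : H)‖ ^ 2 ≤ 0 := by
      by_contra hcon
      push Not at hcon
      have := mul_pos hc hcon
      linarith
    have h4 : ((show a.domain from u) : H) = 0 := by
      have : ‖((show a.domain from u) : H)‖ = 0 := by
        have := sq_nonneg ‖((show a.domain from u) : H)‖
        exact pow_eq_zero_iff (two_ne_zero) |>.1 (le_antisymm h3 this)
      exact norm_eq_zero.1 this
    exact Subtype.ext h4

instance (a : ClosedPositiveForm H) : NormedAddCommGroup a.Space :=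
  a.core.toNormedAddCommGroup

instance (a : ClosedPositiveForm H) : InnerProductSpace ℂ a.Space :=
  InnerProductSpace.ofCore a.core.toCore

theorem inner_def (a : ClosedPositiveForm H) (u v : a.Space) :
    inner ℂ u v = a.form u v := rfl

theorem norm_sq_def (a : ClosedPositiveForm H) (u : a.Space) :
    ‖u‖ ^ 2 = (a.form u u).re := by
  rw [← inner_def, ← inner_self_eq_norm_sq (𝕜 := ℂ)]; rfl

/-- The embedding `H¹ → H` as a linear map. -/
def inclₗ (a : ClosedPositiveForm H) : a.Space →ₗ[ℂ] H := a.domain.subtype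

theorem exists_incl_bound (a : ClosedPositiveForm H) :
    ∃ C : ℝ, ∀ u : a.Space, ‖a.inclₗ u‖ ≤ C * ‖u‖ := by
  obtain ⟨c, hc, h⟩ := a.positive
  refine ⟨Real.sqrt c⁻¹, fun u => ?_⟩
  refine abs_le_of_sq_le_sq' ?_ (by positivity) |>.2
  rw [mul_pow, Real.sq_sqrt (by positivity), norm_sq_def]
  have h1 : c * ‖a.inclₗ u‖ ^ 2 ≤ (a.form u u).re := h u
  rw [inv_mul_eq_div, le_div_iff₀ hc]
  linarith

/-- The continuous embedding `H¹ → H`. -/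
def incl (a : ClosedPositiveForm H) : a.Space →L[ℂ] H :=
  ⟨a.inclₗ, by
    obtain ⟨C, hC⟩ := a.exists_incl_bound
    exact AddMonoidHomClass.continuous_of_bound a.inclₗ C hC⟩

theorem incl_injective (a : ClosedPositiveForm H) : Function.Injective a.incl :=
  a.domain.injective_subtype

theorem range_incl (a : ClosedPositiveForm H) : Set.range a.incl = (a.domain : Set H) :=
  Subtype.range_coe

instance [CompleteSpace H] (a : ClosedPositiveForm H) : CompleteSpace a.Space := by
  refine Metric.complete_of_cauchySeq_tendsto fun u hu => ?_
  have hi : CauchySeq (fun n => a.incl (u n)) := hu.map a.incl.uniformContinuous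
  obtain ⟨x, hx⟩ := cauchySeq_tendsto_of_complete hi
  obtain ⟨y, -, hy⟩ := a.closed u x hx (by
    intro ε hε
    obtain ⟨N, hN⟩ := Metric.cauchySeq_iff.1 hu (Real.sqrt ε) (Real.sqrt_pos.2 hε)
    refine ⟨N, fun m hm n hn => ?_⟩
    have h1 := hN m hm n hn
    rw [dist_eq_norm] at h1
    have h2 : ‖u m - u n‖ ^ 2 < ε := by
      rw [← Real.sq_sqrt hε.le]
      exact pow_lt_pow_left₀ h1 (norm_nonneg _) two_ne_zero
    rw [norm_sq_def] at h2
    exact h2)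
  let y' : a.Space := y
  refine ⟨y', ?_⟩
  rw [tendsto_iff_norm_sub_tendsto_zero]
  have h3 : Tendsto (fun n => ‖u n - y'‖ ^ 2) atTop (𝓝 0) := by
    refine hy.congr fun n => ?_
    rw [norm_sq_def]; rfl
  have h4 := h3.sqrt
  simpa [Real.sqrt_sq] using h4

/-- The graph of the operator `T` determined by `u ∈ U` and `(T u, v) = a[u, v]` for all
`v ∈ W`, where `U`, `W` are subspaces of `H¹`. -/
def opGraph (a : ClosedPositiveForm H) (U W : Submodule ℂ a.Space) : Submodule ℂ (H × H) where
  carrier := {p | ∃ u ∈ U, a.incl u = p.1 ∧ ∀ v ∈ W, inner ℂ p.2 (a.incl v) = inner ℂ u v}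
  zero_mem' := ⟨0, U.zero_mem, by simp, by simp⟩
  add_mem' := by
    rintro p q ⟨u, hu, hp, h⟩ ⟨u', hu', hq, h'⟩
    refine ⟨u + u', U.add_mem hu hu', by simp [hp, hq], fun v hv => ?_⟩
    rw [Prod.snd_add, inner_add_left, inner_add_left, h v hv, h' v hv]
  smul_mem' := by
    rintro c p ⟨u, hu, hp, h⟩
    refine ⟨c • u, U.smul_mem c hu, by simp [hp], fun v hv => ?_⟩
    rw [Prod.smul_snd, inner_smul_left, inner_smul_left, h v hv]

/-- The operator in `H` with graph `a.opGraph U W` (it is a graph when `W` is dense in `H`). -/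
def op (a : ClosedPositiveForm H) (U W : Submodule ℂ a.Space) : H →ₗ.[ℂ] H :=
  (a.opGraph U W).toLinearPMap

theorem op_graph (a : ClosedPositiveForm H) {U W : Submodule ℂ a.Space}
    (hW : Dense (a.incl '' W)) : (a.op U W).graph = a.opGraph U W := by
  refine Submodule.toLinearPMap_graph_eq _ ?_
  rintro ⟨x, f⟩ ⟨u, -, hu, h⟩ hx
  have hu0 : u = 0 := a.incl_injective (by simpa [hu] using hx)
  subst hu0
  refine hW.eq_zero_of_inner_left ℂ ?_
  rintro _ ⟨v, hv, rfl⟩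
  simpa using h v hv

/-- The operator `A_N` generated by the form `a`. -/
def opN (a : ClosedPositiveForm H) : H →ₗ.[ℂ] H := a.op ⊤ ⊤

/-- The inverse of `A_N`, as a bounded operator from `H` to the Hilbert space `H¹`;
see `mem_graph_opN`. -/
def invN [CompleteSpace H] (a : ClosedPositiveForm H) : H →L[ℂ] a.Space :=
  ContinuousLinearMap.adjoint a.incl

theorem dense_incl_top (a : ClosedPositiveForm H) :
    Dense (a.incl '' ((⊤ : Submodule ℂ a.Space) : Set a.Space)) := by
  rw [Submodule.top_coe, Set.image_univ, range_incl]
  exact a.dense_domain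

theorem mem_graph_opN [CompleteSpace H] (a : ClosedPositiveForm H) (x f : H) :
    (x, f) ∈ a.opN.graph ↔ x = a.incl (a.invN f) := by
  rw [opN, op_graph a a.dense_incl_top]
  constructor
  · rintro ⟨u, -, rfl, h⟩
    congr 1
    refine ext_inner_right ℂ fun v => ?_
    rw [invN, ContinuousLinearMap.adjoint_inner_left, ← h v trivial]
  · rintro rfl
    exact ⟨a.invN f, trivial, rfl, fun v _ => by
      rw [invN, ContinuousLinearMap.adjoint_inner_left]⟩

end ClosedPositiveForm

namespace PartialOp

variable {H : Type*} [NormedAddCommGroup H] [InnerProductSpace ℂ H]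

/-- `T - z` as a linear map on the domain of `T`. -/
def shift (T : H →ₗ.[ℂ] H) (z : ℂ) : T.domain →ₗ[ℂ] H :=
  T.toFun - z • T.domain.subtype

/-- `ker (T - z)` as a subspace of `H`. -/
def eigenspace (T : H →ₗ.[ℂ] H) (z : ℂ) : Submodule ℂ H :=
  (LinearMap.ker (shift T z)).map T.domain.subtype

theorem mem_eigenspace_iff (T : H →ₗ.[ℂ] H) (z : ℂ) (u : H) :
    u ∈ eigenspace T z ↔ (u, z • u) ∈ T.graph := by
  simp only [eigenspace, shift, Submodule.mem_map, LinearMap.mem_ker, LinearMap.sub_apply,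
    LinearMap.smul_apply, sub_eq_zero, LinearPMap.mem_graph_iff, Submodule.subtype_apply]
  constructor
  · rintro ⟨y, hy, rfl⟩
    exact ⟨y, rfl, hy⟩
  · rintro ⟨y, rfl, hy⟩
    exact ⟨y, hy, rfl⟩

/-- The essential spectrum: the points `z` at which `T - z` is not a Fredholm operator. For a
self-adjoint `T` this is the spectrum without the isolated eigenvalues of finite multiplicity. -/
def essSpectrum (T : H →ₗ.[ℂ] H) : Set ℂ :=
  {z | ¬ (FiniteDimensional ℂ (LinearMap.ker (shift T z)) ∧
    IsClosed (LinearMap.range (shift T z) : Set H) ∧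
    FiniteDimensional ℂ (H ⧸ LinearMap.range (shift T z)))}

/-- The orthogonal projection onto `ker (T - z)`. The closure changes nothing when `T` is a
closed operator. -/
def eigenproj [CompleteSpace H] (T : H →ₗ.[ℂ] H) (z : ℂ) : H →L[ℂ] H :=
  (eigenspace T z).topologicalClosure.starProjection

end PartialOp

/-- A pair of a form `a` with domain `H¹` and a subspace `H₀¹`, closed in the Hilbert space `H¹`
and dense in `H`. -/
structure FormPair (H : Type*) [NormedAddCommGroup H] [InnerProductSpace ℂ H] where
  /-- the form -/
  a : ClosedPositiveForm H
  /-- the subspace `H₀¹` -/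
  H₀ : Submodule ℂ a.Space
  isClosed_H₀ : IsClosed (H₀ : Set a.Space)
  dense_H₀ : Dense (a.incl '' H₀)

namespace FormPair

open PartialOp

variable {H : Type*} [NormedAddCommGroup H] [InnerProductSpace ℂ H]

/-- The operator `A_N` generated by the form on `H¹`. -/
def AN (P : FormPair H) : H →ₗ.[ℂ] H := P.a.opN

/-- The operator `A_D` generated by the restriction of the form to `H₀¹`. -/
def AD (P : FormPair H) : H →ₗ.[ℂ] H := P.a.op P.H₀ P.H₀

/-- The operator `A`: its domain is the set `H_A¹` of all `u ∈ H¹` for which `v ↦ a[u, v]` is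
`H`-continuous on `H₀¹`, and `(A u, v) = a[u, v]` for all `v ∈ H₀¹`. -/
def A (P : FormPair H) : H →ₗ.[ℂ] H := P.a.op ⊤ P.H₀

/-- The space `G_z = {u ∈ H_A¹ : A u = z u}`, as a subspace of the Hilbert space `H¹`. -/
def G (P : FormPair H) (z : ℂ) : Submodule ℂ P.a.Space :=
  (eigenspace P.A z).comap P.a.incl.toLinearMap

theorem mem_G_iff (P : FormPair H) (z : ℂ) (u : P.a.Space) :
    u ∈ P.G z ↔ ∀ v ∈ P.H₀, inner ℂ (z • P.a.incl u) (P.a.incl v) = inner ℂ u v := by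
  change P.a.incl u ∈ eigenspace P.A z ↔ _
  rw [mem_eigenspace_iff, A, ClosedPositiveForm.op_graph _ P.dense_H₀]
  constructor
  · rintro ⟨w, -, hw, h⟩
    obtain rfl := P.a.incl_injective hw
    exact h
  · intro h
    exact ⟨u, trivial, rfl, h⟩

theorem isClosed_G (P : FormPair H) (z : ℂ) : IsClosed (P.G z : Set P.a.Space) := by
  have : (P.G z : Set P.a.Space) = ⋂ v ∈ P.H₀,
      {u | inner ℂ (z • P.a.incl u) (P.a.incl v) = inner ℂ u v} := by
    ext u
    simp only [SetLike.mem_coe, mem_G_iff, Set.mem_iInter, Set.mem_ofPred_eq]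
  rw [this]
  refine isClosed_biInter fun v _ => isClosed_eq ?_ ?_ <;> fun_prop

instance [CompleteSpace H] (P : FormPair H) (z : ℂ) : CompleteSpace (P.G z) :=
  (P.isClosed_G z).completeSpace_coe

/-- The operator `𝓑_μ = (I - μ Π'_μ A_N⁻¹)|_{G_μ}` in `G_μ`, where `Π'_μ` is the
`H¹`-orthogonal projection onto `G_μ`. -/
def B [CompleteSpace H] (P : FormPair H) (μ : ℝ) : P.G (μ : ℂ) →L[ℂ] P.G (μ : ℂ) :=
  ContinuousLinearMap.id ℂ (P.G (μ : ℂ)) - (μ : ℂ) •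
    ((P.G (μ : ℂ)).orthogonalProjectionOnto ∘L P.a.invN ∘L P.a.incl ∘L (P.G (μ : ℂ)).subtypeL)

/-- The closed subspace `𝓗₀` spanned by the common eigenvectors of `A_N` and `A_D`. -/
def commonSpan (P : FormPair H) : Submodule ℂ H :=
  (Submodule.span ℂ {u | ∃ z w : ℂ, u ∈ eigenspace P.AN z ∧
    u ∈ eigenspace P.AD w}).topologicalClosure

/-- `n_{N,D}(μ) = dim E_B(μ) 𝓗₀`; both choices of `B` give the same subspace. -/
def nND [CompleteSpace H] (P : FormPair H) (μ : ℝ) : ℕ :=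
  Module.finrank ℂ (P.commonSpan.map (eigenproj P.AN μ).toLinearMap)

/-- `n_N(μ) = dim E_N(μ) 𝓗`, where `𝓗` is the orthogonal complement of `𝓗₀`. -/
def nN [CompleteSpace H] (P : FormPair H) (μ : ℝ) : ℕ :=
  Module.finrank ℂ (P.commonSpanᗮ.map (eigenproj P.AN μ).toLinearMap)

/-- `n_D(μ) = dim E_D(μ) 𝓗`, where `𝓗` is the orthogonal complement of `𝓗₀`. -/
def nD [CompleteSpace H] (P : FormPair H) (μ : ℝ) : ℕ :=
  Module.finrank ℂ (P.commonSpanᗮ.map (eigenproj P.AD μ).toLinearMap)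

end FormPair

/-- The real points of the spectrum of a bounded operator. -/
def realSpectrum {G : Type*} [NormedAddCommGroup G] [InnerProductSpace ℂ G]
    (T : G →L[ℂ] G) : Set ℝ :=
  {ν | (ν : ℂ) ∈ spectrum ℂ T}

/-- The spectrum of `T` in the set `S` consists of `n` eigenvalues, counted according to their
multiplicities. -/
def SpectrumConsistsOf {G : Type*} [NormedAddCommGroup G] [InnerProductSpace ℂ G]
    (T : G →L[ℂ] G) (S : Set ℝ) (n : ℕ) : Prop :=
  (realSpectrum T ∩ S).Finite ∧
  (∀ ν ∈ realSpectrum T ∩ S, Module.End.HasEigenvalue T.toLinearMap (ν : ℂ) ∧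
    FiniteDimensional ℂ (Module.End.eigenspace T.toLinearMap (ν : ℂ))) ∧
  ∑ᶠ ν ∈ realSpectrum T ∩ S,
    Module.finrank ℂ (Module.End.eigenspace T.toLinearMap (ν : ℂ)) = n

end

/-! ### Counting eigenvalues of a bounded self-adjoint operator near zero. -/

noncomputable section SpectralCounting

/-! Everything is moved into the Hilbert space `H¹`. Let `K` be the bounded nonnegative operator on
`H¹` that represents the inner product of `H`, put `T_μ = I - μK` and `U = H₀¹`. Then `G_μ` is the
orthogonal complement of `T_μ U`, and `𝓑_μ` is the compression of `T_μ` to `G_μ`. The eigenspaces of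
`A_N` and `A_D` at `l` correspond to `N = ker T_l` and to `D = U ∩ G_l`, the kernel of the
compression of `T_l` to `U`; common eigenvectors correspond to `C = N ∩ D`.

At `μ = l` the kernel of `𝓑_l` is `N + D`. Indeed, if `u ∈ G_l` and `T_l u ⟂ G_l`, then `T_l u = T_l
v` with `v ∈ U`, because `T_l U` is closed; hence `u - v ∈ N`, and `v ∈ D` because `T_l u ⟂ U`. The
quantitative form of this argument, `exists_compression_bound`, also gives the spectral gap around
zero.

For `μ ≠ l` the operator `T_μ` acts on `C` as a nonzero scalar, so `G_μ ⟂ C`: the space `G_μ` jumps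
at `l`, but it is close to `G_l ∩ Cᗮ` (`norm_sub_starProjection_weakKer_le`). The lower bound for
`𝓑_l` off `N + D` therefore persists (`exists_compression_bound_near`), and since `C` is already
excluded, `𝓑_μ` has at most `n_N + n_D = dim (Cᗮ ∩ (N + D))` eigenvalues near zero.

The lower counts come from test vectors `u`, the projections to `G_μ` of `m ∈ Cᗮ`. Up to `O((l -
μ)²)`, the form of `𝓑_μ` at `u` is `(l - μ)(Km, m)` for `m ∈ N` and `-(l - μ)(Km, m)` for `m ∈ D`,
while `𝓑_μ u = O(l - μ)` (`exists_test_expansion`). Hence `𝓑_μ(𝓑_μ ∓ ε)` is negative on spaces of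
dimensions `n_N` and `n_D`, with opposite choices of sign, which forces that many eigenvalues on
each side of zero. Together they exhaust the upper bound, so both counts are exact and zero is not
in the spectrum (`spectrumConsistsOf_of_test_spaces`). -/

open Module.End in
theorem eigenspace_finiteDimensional_of_bound {G W : Type*} [NormedAddCommGroup G]
    [InnerProductSpace ℂ G] [NormedAddCommGroup W] [NormedSpace ℂ W] [FiniteDimensional ℂ W]
    {B : G →L[ℂ] G} {φ : G →L[ℂ] W} {r : ℝ} (hφ : ∀ u, φ u = 0 → r * ‖u‖ ≤ ‖B u‖)
    {t : ℝ} (ht : |t| < r) : FiniteDimensional ℂ (eigenspace B.toLinearMap (t : ℂ)) := by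
  refine FiniteDimensional.of_injective
    (φ.toLinearMap ∘ₗ (eigenspace B.toLinearMap (t : ℂ)).subtype) ?_
  rw [← LinearMap.ker_eq_bot, LinearMap.ker_eq_bot']
  rintro ⟨u, hu⟩ h
  have h1 := hφ u h
  have h2 : B u = (t : ℂ) • u := mem_eigenspace_iff.1 hu
  rw [h2, norm_smul, Complex.norm_real, Real.norm_eq_abs] at h1
  have h3 : ‖u‖ = 0 := by
    by_contra h0
    have : 0 < ‖u‖ := lt_of_le_of_ne (norm_nonneg _) (Ne.symm h0)
    nlinarith
  exact Subtype.ext (norm_eq_zero.1 h3)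

-- If `t` is not an eigenvalue, `B - t` is injective. It is bounded below on `ker φ`, whose
-- complement is finite-dimensional, so its range is closed; by self-adjointness the range is also
-- dense, and `B - t` is invertible.
open Module.End in
theorem hasEigenvalue_of_mem_realSpectrum {G W : Type*} [NormedAddCommGroup G]
    [InnerProductSpace ℂ G] [CompleteSpace G] [NormedAddCommGroup W] [NormedSpace ℂ W]
    [FiniteDimensional ℂ W] {B : G →L[ℂ] G} (hB : IsSelfAdjoint B) {φ : G →L[ℂ] W} {r : ℝ}
    (hφ : ∀ u, φ u = 0 → r * ‖u‖ ≤ ‖B u‖) {t : ℝ} (ht : |t| < r) (hs : t ∈ realSpectrum B) :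
    HasEigenvalue B.toLinearMap (t : ℂ) := by
  by_contra hne
  have hker : eigenspace B.toLinearMap (t : ℂ) = ⊥ := by
    by_contra h
    exact hne h
  set T : G →L[ℂ] G := B - (t : ℂ) • 1 with hT
  have hTa : ∀ u, T u = B u - (t : ℂ) • u := fun u => by simp [hT]
  have hsymm : ∀ u v, inner ℂ (T u) v = inner ℂ u (T v) := by
    intro u v
    have := hB.isSymmetric u v
    simp only [ContinuousLinearMap.coe_coe] at this
    rw [hTa, hTa, inner_sub_left, inner_sub_right, this, inner_smul_left, inner_smul_right]
    simp
  have hinj : ∀ u, T u = 0 → u = 0 := by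
    intro u hu
    have : u ∈ eigenspace B.toLinearMap (t : ℂ) := by
      rw [mem_eigenspace_iff]
      rw [hTa, sub_eq_zero] at hu
      exact hu
    rw [hker] at this
    exact this
  have hclosed1 : IsClosed ((φ.ker.map T.toLinearMap : Submodule ℂ G) : Set G) := by
    have hanti : AntilipschitzWith (Real.toNNReal (r - |t|))⁻¹ (T ∘L φ.ker.subtypeL) := by
      refine ContinuousLinearMap.antilipschitz_of_bound _ fun u => ?_
      have h1 := hφ u.1 u.2
      have h2 : ‖B u.1‖ ≤ ‖T u.1‖ + |t| * ‖u.1‖ := by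
        have : B u.1 = T u.1 + (t : ℂ) • u.1 := by rw [hTa]; abel
        rw [this]
        refine (norm_add_le _ _).trans ?_
        rw [norm_smul, Complex.norm_real, Real.norm_eq_abs]
      rw [NNReal.coe_inv, Real.coe_toNNReal _ (by linarith), inv_mul_eq_div,
        le_div_iff₀ (by linarith)]
      change ‖u.1‖ * _ ≤ ‖T u.1‖
      nlinarith
    have hcl := hanti.isClosed_range (T ∘L φ.ker.subtypeL).uniformContinuous
    convert hcl using 1
    ext y
    simp
  have hfin : FiniteDimensional ℂ (φ.kerᗮ : Submodule ℂ G) := by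
    refine FiniteDimensional.of_injective (φ.toLinearMap ∘ₗ (φ.kerᗮ).subtype) ?_
    rw [← LinearMap.ker_eq_bot, LinearMap.ker_eq_bot']
    rintro ⟨u, hu⟩ h
    have : u ∈ φ.ker := h
    exact Subtype.ext (inner_self_eq_zero.1 (hu u this))
  have hrange : T.range = φ.ker.map T.toLinearMap ⊔ (φ.kerᗮ).map T.toLinearMap := by
    have : CompleteSpace φ.ker := φ.isClosed_ker.completeSpace_coe
    rw [← Submodule.map_sup, Submodule.sup_orthogonal_of_hasOrthogonalProjection,
      Submodule.map_top]
  have hclosed : IsClosed (T.range : Set G) := by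
    rw [hrange]
    exact Submodule.isClosed_sup_finiteDimensional _ _ hclosed1
  have horth : T.rangeᗮ = ⊥ := by
    rw [eq_bot_iff]
    intro y hy
    refine hinj y ?_
    rw [← inner_self_eq_zero (𝕜 := ℂ), ← hsymm]
    exact hy _ ⟨_, rfl⟩
  have hsurj : T.range = ⊤ := by
    have : CompleteSpace T.range := hclosed.completeSpace_coe
    rwa [Submodule.orthogonal_eq_bot_iff] at horth
  have hunit : IsUnit T := by
    rw [ContinuousLinearMap.isUnit_iff_bijective]
    refine ⟨(injective_iff_map_eq_zero T).2 hinj, ?_⟩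
    exact LinearMap.range_eq_top.1 hsurj
  refine hs ?_
  rw [spectrum.mem_resolventSet_iff]
  have : algebraMap ℂ (G →L[ℂ] G) (t : ℂ) - B = -T := by
    rw [hT, Algebra.algebraMap_eq_smul_one]; abel
  rw [this]
  exact hunit.neg

-- On the orthogonal sum of these eigenspaces `‖B x‖ < r ‖x‖` for `x ≠ 0`, so the sum meets `ker φ`
-- only in zero and `φ` embeds it into `W`.
open Module.End in
theorem sum_finrank_eigenspace_le {G W : Type*} [NormedAddCommGroup G]
    [InnerProductSpace ℂ G] [CompleteSpace G] [NormedAddCommGroup W] [NormedSpace ℂ W]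
    [FiniteDimensional ℂ W] {B : G →L[ℂ] G} (hB : IsSelfAdjoint B) {φ : G →L[ℂ] W} {r : ℝ}
    (hφ : ∀ u, φ u = 0 → r * ‖u‖ ≤ ‖B u‖) (s : Finset ℝ) (hs : ∀ t ∈ s, |t| < r) :
    ∑ t ∈ s, Module.finrank ℂ (eigenspace B.toLinearMap (t : ℂ)) ≤ Module.finrank ℂ W := by
  have hfd : ∀ t : s, FiniteDimensional ℂ (eigenspace B.toLinearMap ((t : ℝ) : ℂ)) :=
    fun t => eigenspace_finiteDimensional_of_bound hφ (hs t t.2)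
  have hort : OrthogonalFamily ℂ (fun t : s => eigenspace B.toLinearMap ((t : ℝ) : ℂ))
      fun t => (eigenspace B.toLinearMap ((t : ℝ) : ℂ)).subtypeₗᵢ :=
    hB.isSymmetric.orthogonalFamily_eigenspaces.comp
      (Complex.ofReal_injective.comp Subtype.val_injective)
  rw [← Finset.sum_coe_sort s, ← Module.finrank_pi_fintype]
  let Ψ : (∀ t : s, eigenspace B.toLinearMap ((t : ℝ) : ℂ)) →ₗ[ℂ] G :=
    ∑ t : s, (eigenspace B.toLinearMap ((t : ℝ) : ℂ)).subtype ∘ₗ LinearMap.proj t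
  have hΨ : ∀ x, Ψ x = ∑ t : s, (x t : G) := fun x => by simp [Ψ]
  refine LinearMap.finrank_le_finrank_of_injective (f := φ.toLinearMap ∘ₗ Ψ) ?_
  rw [← LinearMap.ker_eq_bot, LinearMap.ker_eq_bot']
  intro x hx
  have h1 := hφ (Ψ x) hx
  have h2 : ‖Ψ x‖ ^ 2 = ∑ t : s, ‖x t‖ ^ 2 := by
    rw [hΨ]
    exact hort.norm_sum x Finset.univ
  have h3 : ‖B (Ψ x)‖ ^ 2 = ∑ t : s, (t : ℝ) ^ 2 * ‖x t‖ ^ 2 := by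
    have : B (Ψ x) =
        ∑ t : s, ((((t : ℝ) : ℂ) • x t : eigenspace B.toLinearMap ((t : ℝ) : ℂ)) : G) := by
      rw [hΨ, map_sum]
      exact Finset.sum_congr rfl fun t _ => mem_eigenspace_iff.1 (x t).2
    rw [this]
    refine (hort.norm_sum (fun t => ((t : ℝ) : ℂ) • x t) Finset.univ).trans ?_
    refine Finset.sum_congr rfl fun t _ => ?_
    rw [norm_smul, mul_pow, Complex.norm_real, Real.norm_eq_abs, sq_abs]
  by_contra hne
  obtain ⟨t₀, ht₀⟩ : ∃ t, x t ≠ 0 := by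
    by_contra! h
    exact hne (funext h)
  have hr : 0 < r := (abs_nonneg _).trans_lt (hs t₀ t₀.2)
  have h4 : ‖B (Ψ x)‖ ^ 2 < r ^ 2 * ‖Ψ x‖ ^ 2 := by
    rw [h3, h2, Finset.mul_sum]
    refine Finset.sum_lt_sum (fun t _ => ?_) ⟨t₀, Finset.mem_univ _, ?_⟩
    · exact mul_le_mul_of_nonneg_right
        (sq_lt_sq.2 ((hs t t.2).trans_le (le_abs_self r))).le (by positivity)
    · have : 0 < ‖x t₀‖ := norm_pos_iff.2 ht₀
      exact mul_lt_mul_of_pos_right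
        (sq_lt_sq.2 ((hs t₀ t₀.2).trans_le (le_abs_self r))) (by positivity)
  rw [← mul_pow] at h4
  exact absurd (lt_of_pow_lt_pow_left₀ 2 (by positivity) h4) (not_lt.2 h1)

open Module.End in
theorem realSpectrum_inter_finite {G W : Type*} [NormedAddCommGroup G]
    [InnerProductSpace ℂ G] [CompleteSpace G] [NormedAddCommGroup W] [NormedSpace ℂ W]
    [FiniteDimensional ℂ W] {B : G →L[ℂ] G} (hB : IsSelfAdjoint B) {φ : G →L[ℂ] W} {r : ℝ}
    (hφ : ∀ u, φ u = 0 → r * ‖u‖ ≤ ‖B u‖) {S : Set ℝ} (hS : ∀ t ∈ S, |t| < r) :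
    (realSpectrum B ∩ S).Finite := by
  by_contra hinf
  obtain ⟨s, hs, hcard⟩ := Set.Infinite.exists_subset_card_eq hinf (Module.finrank ℂ W + 1)
  have h1 := sum_finrank_eigenspace_le hB hφ s fun t ht => hS t (hs ht).2
  have h2 : ∑ t ∈ s, 1 ≤ ∑ t ∈ s, Module.finrank ℂ (eigenspace B.toLinearMap (t : ℂ)) := by
    refine Finset.sum_le_sum fun t ht => ?_
    have := eigenspace_finiteDimensional_of_bound hφ (hS t (hs ht).2)
    have hev := hasEigenvalue_of_mem_realSpectrum hB hφ (hS t (hs ht).2) (hs ht).1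
    exact Submodule.one_le_finrank_iff.2 hev
  simp only [Finset.sum_const, smul_eq_mul, mul_one] at h2
  omega

/-- A self-adjoint operator without spectrum in `(a, b)` satisfies `(B - a)(B - b) ≥ 0`. -/
theorem re_inner_nonneg_of_spectral_gap {G : Type*} [NormedAddCommGroup G]
    [InnerProductSpace ℂ G] [CompleteSpace G] {B : G →L[ℂ] G} (hB : IsSelfAdjoint B) {a b : ℝ}
    (hab : a ≤ b) (hgap : ∀ t ∈ realSpectrum B, t ∉ Set.Ioo a b) (u : G) :
    0 ≤ (inner ℂ (B u - (a : ℂ) • u) (B u - (b : ℂ) • u)).re := by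
  -- The polynomial `(x - a)(x - b)` is nonnegative outside `(a, b)`, hence on the spectrum.
  have h1 : 0 ≤ cfc (fun x : ℝ => (x - a) * (x - b)) B := by
    refine cfc_nonneg fun x hx => ?_
    have hx' : x ∈ realSpectrum B := by
      rw [← spectrum.algebraMap_mem_iff ℂ] at hx
      exact hx
    have := hgap x hx'
    rw [Set.mem_Ioo, not_and_or, not_lt, not_lt] at this
    by_contra hneg
    push Not at hneg
    rcases mul_neg_iff.1 hneg with h | h <;> rcases this with h' | h' <;> nlinarith
  have h2 : cfc (fun x : ℝ => (x - a) * (x - b)) B =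
      (B - (a : ℂ) • 1) * (B - (b : ℂ) • 1) := by
    rw [cfc_mul (fun x : ℝ => x - a) (fun x : ℝ => x - b) B,
      cfc_sub (fun x : ℝ => x) (fun _ => a) B,
      cfc_sub (fun x : ℝ => x) (fun _ => b) B, cfc_id' ℝ B, cfc_const a B, cfc_const b B,
      Algebra.algebraMap_eq_smul_one, Algebra.algebraMap_eq_smul_one]
    rfl
  rw [h2, ContinuousLinearMap.nonneg_iff_isPositive] at h1
  have h3 := h1.re_inner_nonneg_right u
  have h4 : ∀ v w : G, inner ℂ v ((B - (a : ℂ) • 1 : G →L[ℂ] G) w) =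
      inner ℂ (B v - (a : ℂ) • v) w := by
    intro v w
    have := hB.isSymmetric v w
    simp only [ContinuousLinearMap.coe_coe] at this
    simp [this]
  rw [mul_apply_eq_comp, h4] at h3
  simpa using h3

-- A variational lower bound. If the projection of `f x` to every eigenspace in `(a, b)` vanishes,
-- then `f x` lies in an invariant subspace on which `B` has no spectrum in `(a, b)`. There `(B -
-- a)(B - b) ≥ 0`, which contradicts `hf` unless `x = 0`.
open Module.End in
theorem finrank_le_finsum_finrank_eigenspace {G W L : Type*} [NormedAddCommGroup G]
    [InnerProductSpace ℂ G] [CompleteSpace G] [NormedAddCommGroup W] [NormedSpace ℂ W]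
    [FiniteDimensional ℂ W] [AddCommGroup L] [Module ℂ L]
    {B : G →L[ℂ] G} (hB : IsSelfAdjoint B) {φ : G →L[ℂ] W} {r : ℝ}
    (hφ : ∀ u, φ u = 0 → r * ‖u‖ ≤ ‖B u‖) {a b : ℝ} (hle : a ≤ b)
    (hab : ∀ t ∈ Set.Ioo a b, |t| < r)
    (f : L →ₗ[ℂ] G)
    (hf : ∀ x, x ≠ 0 → (inner ℂ (B (f x) - (a : ℂ) • f x) (B (f x) - (b : ℂ) • f x)).re < 0) :
    Module.finrank ℂ L ≤ ∑ᶠ t ∈ realSpectrum B ∩ Set.Ioo a b,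
      Module.finrank ℂ (eigenspace B.toLinearMap (t : ℂ)) := by
  have hfin := realSpectrum_inter_finite hB hφ hab
  rw [finsum_mem_eq_finite_toFinset_sum _ hfin]
  set s := hfin.toFinset with hs
  have hst : ∀ t ∈ s, t ∈ realSpectrum B ∩ Set.Ioo a b := fun t ht => by simpa [hs] using ht
  have hfd : ∀ t : s, FiniteDimensional ℂ (eigenspace B.toLinearMap ((t : ℝ) : ℂ)) :=
    fun t => eigenspace_finiteDimensional_of_bound hφ (hab t (hst t t.2).2)
  rw [← Finset.sum_coe_sort s, ← Module.finrank_pi_fintype]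
  let Φ : L →ₗ[ℂ] (∀ t : s, eigenspace B.toLinearMap ((t : ℝ) : ℂ)) :=
    LinearMap.pi fun t =>
      (eigenspace B.toLinearMap ((t : ℝ) : ℂ)).orthogonalProjectionOnto.toLinearMap ∘ₗ f
  refine LinearMap.finrank_le_finrank_of_injective (f := Φ) ?_
  rw [← LinearMap.ker_eq_bot, LinearMap.ker_eq_bot']
  intro x hx
  by_contra hne
  refine absurd (hf x hne) (not_lt.2 ?_)
  set F : Submodule ℂ G := ⨅ t : s, (eigenspace B.toLinearMap ((t : ℝ) : ℂ))ᗮ with hF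
  have hxF : f x ∈ F := by
    rw [hF, Submodule.mem_iInf]
    intro t
    rw [← Submodule.orthogonalProjectionOnto_eq_zero_iff]
    exact congrFun hx t
  have hFinv : ∀ u : F, B u ∈ F := by
    intro u
    refine (Submodule.mem_iInf _).2 ?_
    intro t w hw
    have h1 := hB.isSymmetric w u
    simp only [ContinuousLinearMap.coe_coe] at h1
    have h2 : B w = ((t : ℝ) : ℂ) • w := mem_eigenspace_iff.1 hw
    rw [← h1, h2, inner_smul_left, (Submodule.mem_iInf _).1 u.2 t w hw, mul_zero]
  have hFcl : IsClosed (F : Set G) := by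
    rw [hF, Submodule.coe_iInf]
    exact isClosed_iInter fun t => Submodule.isClosed_orthogonal _
  have : CompleteSpace F := hFcl.completeSpace_coe
  let B' : F →L[ℂ] F := (B ∘L F.subtypeL).codRestrict F hFinv
  have hB' : IsSelfAdjoint B' := by
    rw [ContinuousLinearMap.isSelfAdjoint_iff_isSymmetric]
    intro u v
    exact hB.isSymmetric u v
  -- The bound off `ker φ` passes to the restriction, so a spectral point in the gap would be an
  -- eigenvalue of it. Its eigenvector would lie in one of the eigenspaces to which `F` is
  -- orthogonal.
  have hgap : ∀ t ∈ realSpectrum B', t ∉ Set.Ioo a b := by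
    intro t ht htab
    have hev := hasEigenvalue_of_mem_realSpectrum (φ := φ ∘L F.subtypeL) hB'
      (fun u hu => hφ u hu) (hab t htab) ht
    obtain ⟨w, hw⟩ := hev.exists_hasEigenvector
    have hBw : B (w : G) = (t : ℂ) • (w : G) := congrArg Subtype.val hw.apply_eq_smul
    have hw0 : (w : G) ≠ 0 := fun h => hw.2 (Subtype.ext h)
    have hmem : (w : G) ∈ eigenspace B.toLinearMap (t : ℂ) := mem_eigenspace_iff.2 hBw
    have hts : t ∈ s := by
      rw [hs, Set.Finite.mem_toFinset]
      refine ⟨?_, htab⟩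
      refine spectrum.mem_iff.2 fun hu => ?_
      rw [ContinuousLinearMap.isUnit_iff_bijective] at hu
      refine hw0 (hu.1 ?_)
      rw [map_zero, Algebra.algebraMap_eq_smul_one]
      simp [hBw]
    exact hw0 (inner_self_eq_zero.1 ((Submodule.mem_iInf _).1 w.2 ⟨t, hts⟩ w hmem))
  exact re_inner_nonneg_of_spectral_gap hB' hle hgap ⟨f x, hxF⟩

theorem finsum_mem_finrank_eigenspace_le {G W : Type*} [NormedAddCommGroup G]
    [InnerProductSpace ℂ G] [CompleteSpace G] [NormedAddCommGroup W] [NormedSpace ℂ W]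
    [FiniteDimensional ℂ W] {B : G →L[ℂ] G} (hB : IsSelfAdjoint B) {φ : G →L[ℂ] W} {r : ℝ}
    (hφ : ∀ u, φ u = 0 → r * ‖u‖ ≤ ‖B u‖) {S : Set ℝ} (hS : ∀ t ∈ S, |t| < r) :
    ∑ᶠ t ∈ realSpectrum B ∩ S, Module.finrank ℂ (Module.End.eigenspace B.toLinearMap (t : ℂ)) ≤
      Module.finrank ℂ W := by
  have hfin := realSpectrum_inter_finite hB hφ hS
  rw [finsum_mem_eq_finite_toFinset_sum _ hfin]
  exact sum_finrank_eigenspace_le hB hφ _ fun t ht => hS t ((hfin.mem_toFinset.1 ht).2)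

/-- Two-sided count of the eigenvalues near zero: the upper bound comes from a subspace of
codimension `dim W` on which `B` is bounded below, the lower bounds from test subspaces. -/
theorem spectrumConsistsOf_of_test_spaces {G W L₁ L₂ : Type*} [NormedAddCommGroup G]
    [InnerProductSpace ℂ G] [CompleteSpace G] [NormedAddCommGroup W] [NormedSpace ℂ W]
    [FiniteDimensional ℂ W] [AddCommGroup L₁] [Module ℂ L₁] [AddCommGroup L₂] [Module ℂ L₂]
    {B : G →L[ℂ] G} (hB : IsSelfAdjoint B) {φ : G →L[ℂ] W} {ε r : ℝ} (hε : 0 < ε) (hεr : ε < r)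
    (hφ : ∀ u, φ u = 0 → r * ‖u‖ ≤ ‖B u‖)
    (hW : Module.finrank ℂ W ≤ Module.finrank ℂ L₁ + Module.finrank ℂ L₂)
    (f₁ : L₁ →ₗ[ℂ] G) (hf₁ : ∀ x, x ≠ 0 →
      ‖B (f₁ x)‖ ^ 2 + ε * (inner ℂ (B (f₁ x)) (f₁ x)).re < 0)
    (f₂ : L₂ →ₗ[ℂ] G) (hf₂ : ∀ x, x ≠ 0 →
      ‖B (f₂ x)‖ ^ 2 - ε * (inner ℂ (B (f₂ x)) (f₂ x)).re < 0) :
    SpectrumConsistsOf B (Set.Ioo (-ε) 0) (Module.finrank ℂ L₁) ∧ 0 ∉ realSpectrum B ∧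
      SpectrumConsistsOf B (Set.Ioo 0 ε) (Module.finrank ℂ L₂) := by
  have hsym : ∀ u : G, (inner ℂ u (B u)).re = (inner ℂ (B u) u).re := fun u =>
    (inner_re_symm (𝕜 := ℂ) u (B u))
  have hnsq : ∀ u : G, (inner ℂ u u).re = ‖u‖ ^ 2 := fun u => inner_self_eq_norm_sq (𝕜 := ℂ) u
  have habs : ∀ t ∈ Set.Ioo (-ε) ε, |t| < r := fun t ht => (abs_lt.2 ht).trans hεr
  have hneg : ∀ t ∈ Set.Ioo (-ε) 0, |t| < r := fun t ht => habs t ⟨ht.1, ht.2.trans hε⟩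
  have hpos : ∀ t ∈ Set.Ioo 0 ε, |t| < r := fun t ht => habs t ⟨by linarith [ht.1], ht.2⟩
  have h0 : ∀ t ∈ ({0} : Set ℝ), |t| < r := fun t ht => by
    rw [Set.mem_singleton_iff.1 ht, abs_zero]; linarith
  have h1 := finrank_le_finsum_finrank_eigenspace hB hφ (by linarith) hneg f₁ fun x hx => by
    have := hf₁ x hx
    rw [← hnsq] at this
    simp only [inner_sub_left, inner_smul_left, Complex.sub_re, Complex.ofReal_neg,
      Complex.ofReal_zero, zero_smul, sub_zero, map_neg, Complex.conj_ofReal, neg_mul,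
      Complex.neg_re, Complex.re_ofReal_mul, hsym]
    linarith
  have h2 := finrank_le_finsum_finrank_eigenspace hB hφ hε.le hpos f₂ fun x hx => by
    have := hf₂ x hx
    rw [← hnsq] at this
    simp only [inner_sub_right, inner_smul_right, Complex.sub_re,
      Complex.ofReal_zero, zero_smul, sub_zero, Complex.re_ofReal_mul]
    linarith
  have h3 := finsum_mem_finrank_eigenspace_le hB hφ habs
  have hsplit : realSpectrum B ∩ Set.Ioo (-ε) ε = (realSpectrum B ∩ Set.Ioo (-ε) 0) ∪
      ((realSpectrum B ∩ {0}) ∪ (realSpectrum B ∩ Set.Ioo 0 ε)) := by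
    rw [← Set.inter_union_distrib_left, ← Set.inter_union_distrib_left]
    congr 1
    ext t
    simp only [Set.mem_Ioo, Set.mem_union, Set.mem_singleton_iff]
    constructor
    · rintro ⟨ha, hb⟩
      rcases lt_trichotomy t 0 with h | h | h
      · exact Or.inl ⟨ha, h⟩
      · exact Or.inr (Or.inl h)
      · exact Or.inr (Or.inr ⟨h, hb⟩)
    · rintro (h | h | h)
      · exact ⟨h.1, h.2.trans hε⟩
      · rw [h]; exact ⟨by linarith, hε⟩
      · exact ⟨by linarith [h.1], h.2⟩
  have hfn := realSpectrum_inter_finite hB hφ hneg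
  have hfp := realSpectrum_inter_finite hB hφ hpos
  have hf0 := realSpectrum_inter_finite hB hφ h0
  rw [hsplit, finsum_mem_union (Set.disjoint_left.2 ?_) hfn (hf0.union hfp),
    finsum_mem_union (Set.disjoint_left.2 ?_) hf0 hfp] at h3
  rotate_left
  · rintro t ⟨-, ht⟩ ⟨-, ht'⟩
    exact absurd ht'.1 (by rw [Set.mem_singleton_iff.1 ht]; exact lt_irrefl _)
  · rintro t ⟨-, ht⟩ (⟨-, ht'⟩ | ⟨-, ht'⟩)
    · exact absurd ht.2 (by rw [Set.mem_singleton_iff.1 ht']; exact lt_irrefl _)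
    · exact lt_asymm ht.2 ht'.1
  have hev : ∀ S : Set ℝ, (∀ t ∈ S, |t| < r) → ∀ ν ∈ realSpectrum B ∩ S,
      Module.End.HasEigenvalue B.toLinearMap (ν : ℂ) ∧
        FiniteDimensional ℂ (Module.End.eigenspace B.toLinearMap (ν : ℂ)) :=
    fun S hS ν hν => ⟨hasEigenvalue_of_mem_realSpectrum hB hφ (hS ν hν.2) hν.1,
      eigenspace_finiteDimensional_of_bound hφ (hS ν hν.2)⟩
  -- The multiplicities on the negative side, at zero and on the positive side add up to at most
  -- `dim L₁ + dim L₂`, while the two sides alone reach this number. So both counts are equalities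
  -- and nothing is left at zero.
  refine ⟨⟨hfn, hev _ hneg, by omega⟩, fun hmem => ?_, ⟨hfp, hev _ hpos, by omega⟩⟩
  have heq : realSpectrum B ∩ {0} = {0} := by
    rw [Set.inter_eq_right, Set.singleton_subset_iff]; exact hmem
  rw [heq, finsum_mem_singleton] at h3
  obtain ⟨he, hf⟩ := hev _ h0 0 ⟨hmem, rfl⟩
  have : 1 ≤ Module.finrank ℂ (Module.End.eigenspace B.toLinearMap ((0 : ℝ) : ℂ)) :=
    Submodule.one_le_finrank_iff.2 he
  omega

/-- An eigenvector for `t ≠ 0` is orthogonal to the kernel, so `φ` kills it by `hker` and the lower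
bound gives `|t| ≥ r`. -/
theorem spectrumConsistsOf_kernel {G W : Type*} [NormedAddCommGroup G]
    [InnerProductSpace ℂ G] [CompleteSpace G] [NormedAddCommGroup W] [NormedSpace ℂ W]
    [FiniteDimensional ℂ W] {B : G →L[ℂ] G} (hB : IsSelfAdjoint B) {φ : G →L[ℂ] W} {ε r : ℝ}
    (hε : 0 < ε) (hεr : ε < r) (hφ : ∀ u, φ u = 0 → r * ‖u‖ ≤ ‖B u‖)
    (hker : ∀ u, (∀ w, B w = 0 → inner ℂ w u = 0) → φ u = 0) :
    realSpectrum B ∩ Set.Ioo (-ε) ε ⊆ {0} ∧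
      SpectrumConsistsOf B (Set.Ioo (-ε) ε) (Module.finrank ℂ B.ker) := by
  have habs : ∀ t ∈ Set.Ioo (-ε) ε, |t| < r := fun t ht => (abs_lt.2 ht).trans hεr
  have hsub : realSpectrum B ∩ Set.Ioo (-ε) ε ⊆ {0} := by
    rintro t ⟨ht, htε⟩
    by_contra hne
    rw [Set.mem_singleton_iff] at hne
    obtain ⟨w, hw⟩ :=
      (hasEigenvalue_of_mem_realSpectrum hB hφ (habs t htε) ht).exists_hasEigenvector
    have hBw : B w = (t : ℂ) • w := hw.apply_eq_smul
    have h1 := hφ w (hker w fun v hv => by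
      have h := hB.isSymmetric v w
      simp only [ContinuousLinearMap.coe_coe, hv, hBw, inner_zero_left, inner_smul_right] at h
      exact (mul_eq_zero.1 h.symm).resolve_left (by exact_mod_cast hne))
    rw [hBw, norm_smul, Complex.norm_real, Real.norm_eq_abs] at h1
    have := le_of_mul_le_mul_right h1 (norm_pos_iff.2 hw.2)
    exact absurd (habs t htε) (not_lt.2 this)
  have h0 : |(0 : ℝ)| < r := by rw [abs_zero]; linarith
  have hE : Module.End.eigenspace B.toLinearMap ((0 : ℝ) : ℂ) = B.ker := by
    rw [Complex.ofReal_zero, Module.End.eigenspace_zero]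
  refine ⟨hsub, (Set.finite_singleton 0).subset hsub, fun ν hν =>
    ⟨hasEigenvalue_of_mem_realSpectrum hB hφ (habs ν hν.2) hν.1,
      eigenspace_finiteDimensional_of_bound hφ (habs ν hν.2)⟩, ?_⟩
  by_cases hmem : 0 ∈ realSpectrum B
  · have : realSpectrum B ∩ Set.Ioo (-ε) ε = {0} :=
      hsub.antisymm (Set.singleton_subset_iff.2 ⟨hmem, by linarith, hε⟩)
    rw [this, finsum_mem_singleton, hE]
  · have : realSpectrum B ∩ Set.Ioo (-ε) ε = ∅ := by
      rw [Set.eq_empty_iff_forall_notMem]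
      intro t ht
      have h := hsub ht
      rw [Set.mem_singleton_iff] at h
      exact hmem (h ▸ ht.1)
    rw [this, finsum_mem_empty]
    have hu : IsUnit B := by
      by_contra hnu
      refine hmem ?_
      change ((0 : ℝ) : ℂ) ∈ spectrum ℂ B
      rw [Complex.ofReal_zero]
      exact spectrum.zero_mem (R := ℂ) hnu
    rw [ContinuousLinearMap.isUnit_iff_bijective] at hu
    rw [show B.ker = ⊥ from LinearMap.ker_eq_bot.2 hu.1, finrank_bot]

end SpectralCounting

/-! ### The pencil `I - μK`, its weak solution spaces, and the compression at `μ = l`. -/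

noncomputable section Pencil

variable {V : Type*} [NormedAddCommGroup V] [InnerProductSpace ℂ V]

/-- The operator pencil `I - μ K`. -/
def pencil (K : V →L[ℂ] V) (μ : ℝ) : V →L[ℂ] V := 1 - (μ : ℂ) • K

theorem pencil_apply (K : V →L[ℂ] V) (μ : ℝ) (u : V) : pencil K μ u = u - (μ : ℂ) • K u := by
  simp [pencil]

theorem pencil_symm {K : V →L[ℂ] V} (hK : K.toLinearMap.IsSymmetric) (μ : ℝ) (u v : V) :
    inner ℂ (pencil K μ u) v = inner ℂ u (pencil K μ v) := by
  have := hK u v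
  simp only [ContinuousLinearMap.coe_coe] at this
  simp [pencil_apply, this]

theorem pencil_eq_add (K : V →L[ℂ] V) (μ ν : ℝ) (u : V) :
    pencil K μ u = pencil K ν u + ((ν - μ : ℝ) : ℂ) • K u := by
  rw [pencil_apply, pencil_apply, Complex.ofReal_sub, sub_smul]; abel

theorem norm_ofReal_smul_apply_le (K : V →L[ℂ] V) (t : ℝ) (u : V) :
    ‖(t : ℂ) • K u‖ ≤ |t| * ‖K‖ * ‖u‖ := by
  rw [norm_smul, Complex.norm_real, Real.norm_eq_abs, mul_assoc]
  exact mul_le_mul_of_nonneg_left (K.le_opNorm u) (abs_nonneg _)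

theorem norm_pencil_apply_le (K : V →L[ℂ] V) (μ ν : ℝ) (u : V) :
    ‖pencil K μ u‖ ≤ (‖pencil K ν‖ + |ν - μ| * ‖K‖) * ‖u‖ := by
  rw [pencil_eq_add K μ ν u, add_mul]
  exact (norm_add_le _ _).trans (add_le_add ((pencil K ν).le_opNorm u)
    (norm_ofReal_smul_apply_le K _ u))

/-- The space of weak solutions of `u = μ K u` tested on `U`. -/
def weakKer (K : V →L[ℂ] V) (U : Submodule ℂ V) (μ : ℝ) : Submodule ℂ V :=
  (U.map (pencil K μ).toLinearMap)ᗮ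

theorem mem_weakKer {K : V →L[ℂ] V} {U : Submodule ℂ V} {μ : ℝ} {u : V} :
    u ∈ weakKer K U μ ↔ ∀ v ∈ U, inner ℂ (pencil K μ v) u = 0 := by
  rw [weakKer, Submodule.mem_orthogonal]
  constructor
  · intro h v hv
    exact h _ ⟨v, hv, rfl⟩
  · rintro h _ ⟨v, hv, rfl⟩
    exact h v hv

instance [CompleteSpace V] (K : V →L[ℂ] V) (U : Submodule ℂ V) (μ : ℝ) :
    CompleteSpace (weakKer K U μ) :=
  (Submodule.isClosed_orthogonal _).completeSpace_coe

/-- The kernel of the compression of `I - μ K` to `U`. -/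
def compressedKer (K : V →L[ℂ] V) (U : Submodule ℂ V) (μ : ℝ) : Submodule ℂ V :=
  U ⊓ weakKer K U μ

/-- The part of the kernel of `I - μ K` in `U`. -/
def commonKer (K : V →L[ℂ] V) (U : Submodule ℂ V) (μ : ℝ) : Submodule ℂ V :=
  U ⊓ (pencil K μ).ker

theorem ker_le_weakKer {K : V →L[ℂ] V} (hK : K.toLinearMap.IsSymmetric) (U : Submodule ℂ V)
    (μ : ℝ) : (pencil K μ).ker ≤ weakKer K U μ := by
  intro u hu
  rw [mem_weakKer]
  intro v _
  rw [pencil_symm hK, show pencil K μ u = 0 from hu, inner_zero_right]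

theorem commonKer_le_compressedKer {K : V →L[ℂ] V} (hK : K.toLinearMap.IsSymmetric)
    (U : Submodule ℂ V) (μ : ℝ) : commonKer K U μ ≤ compressedKer K U μ :=
  inf_le_inf_left _ (ker_le_weakKer hK U μ)

theorem commonKer_eq_inf {K : V →L[ℂ] V} (hK : K.toLinearMap.IsSymmetric)
    (U : Submodule ℂ V) (μ : ℝ) :
    commonKer K U μ = (pencil K μ).ker ⊓ compressedKer K U μ := by
  refine le_antisymm (le_inf inf_le_right (commonKer_le_compressedKer hK U μ)) ?_
  exact le_inf (inf_le_right.trans inf_le_left) inf_le_left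

/-- For `l ≠ 0`, `c` satisfies `K c = l⁻¹ c` and the scalar is `1 - μ/l`; for `l = 0` the pencil is
the identity and `c = 0`. -/
theorem exists_pencil_eq_smul {K : V →L[ℂ] V} {l : ℝ} {c : V} (hc : pencil K l c = 0) (μ : ℝ) :
    ∃ z : ℂ, pencil K μ c = z • c ∧ (z = 0 → μ ≠ l → c = 0) := by
  rw [pencil_apply, sub_eq_zero] at hc
  rcases eq_or_ne l 0 with rfl | hl
  · simp only [Complex.ofReal_zero, zero_smul] at hc
    exact ⟨0, by simp [hc], fun _ _ => hc⟩
  · have hl' : (l : ℂ) ≠ 0 := by exact_mod_cast hl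
    have hKc : K c = (l : ℂ)⁻¹ • c := by
      conv_rhs => rw [hc]
      rw [smul_smul, inv_mul_cancel₀ hl', one_smul]
    refine ⟨1 - μ * (l : ℂ)⁻¹, ?_, fun hz hne => ?_⟩
    · rw [pencil_apply, hKc, smul_smul, sub_smul, one_smul]
    · exfalso
      apply hne
      rw [sub_eq_zero, eq_mul_inv_iff_mul_eq₀ hl', one_mul] at hz
      exact_mod_cast hz.symm

theorem pencil_mem_commonKer {K : V →L[ℂ] V} {U : Submodule ℂ V} {l : ℝ} {c : V}
    (hc : c ∈ commonKer K U l) (μ : ℝ) : pencil K μ c ∈ commonKer K U l := by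
  obtain ⟨z, hz, -⟩ := exists_pencil_eq_smul (K := K) hc.2 μ
  rw [hz]
  exact Submodule.smul_mem _ _ hc

/-- Away from `μ = l` the weak solutions are orthogonal to the common kernel at `l`. -/
theorem weakKer_le_commonKer_orthogonal {K : V →L[ℂ] V}
    (U : Submodule ℂ V) {l μ : ℝ} (hne : μ ≠ l) : weakKer K U μ ≤ (commonKer K U l)ᗮ := by
  intro u hu c hc
  obtain ⟨z, hz, hz0⟩ := exists_pencil_eq_smul (K := K) hc.2 μ
  have h := mem_weakKer.1 hu c hc.1
  rw [hz, inner_smul_left] at h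
  rcases mul_eq_zero.1 h with h | h
  · rw [hz0 (by simpa using h) hne, inner_zero_left]
  · exact h

theorem pencil_mem_commonKer_orthogonal {K : V →L[ℂ] V} (hK : K.toLinearMap.IsSymmetric)
    {U : Submodule ℂ V} {l : ℝ} {v : V} (hv : v ∈ (commonKer K U l)ᗮ) (μ : ℝ) :
    pencil K μ v ∈ (commonKer K U l)ᗮ := by
  intro c hc
  rw [← pencil_symm hK]
  exact hv _ (pencil_mem_commonKer hc μ)

theorem starProjection_eq_zero_of_mem_weakKer {K : V →L[ℂ] V} (hK : K.toLinearMap.IsSymmetric)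
    {U : Submodule ℂ V} [U.HasOrthogonalProjection] {μ : ℝ} {u : V} (hu : u ∈ weakKer K U μ) :
    U.starProjection (pencil K μ u) = 0 := by
  rw [Submodule.starProjection_apply_eq_zero_iff]
  intro v hv
  rw [← pencil_symm hK]
  exact mem_weakKer.1 hu v hv

theorem exists_norm_le_of_finiteDimensional {W : Type*} [NormedAddCommGroup W] [NormedSpace ℂ W]
    (X : Submodule ℂ V) [FiniteDimensional ℂ X] (T : V →L[ℂ] W)
    (hT : ∀ x ∈ X, T x = 0 → x = 0) : ∃ k : ℝ, 0 < k ∧ ∀ x ∈ X, ‖x‖ ≤ k * ‖T x‖ := by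
  obtain ⟨k, hk, h⟩ := (T.toLinearMap ∘ₗ X.subtype).exists_antilipschitzWith
    (LinearMap.ker_eq_bot'.2 fun x hx => Subtype.ext (hT x x.2 hx))
  refine ⟨k, hk, fun x hx => ?_⟩
  have := h.le_mul_dist ⟨x, hx⟩ 0
  simpa [dist_zero_right] using this

/-- Passing from the compression to the full pencil enlarges the good subspace of `U` from `Dᗮ` to
`Cᗮ`: the extra directions `D ∩ Cᗮ` are finite-dimensional and the pencil is injective on them. -/
theorem exists_pencil_bound {K : V →L[ℂ] V} (hK : K.toLinearMap.IsSymmetric)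
    {U : Submodule ℂ V} [U.HasOrthogonalProjection] {l : ℝ}
    [FiniteDimensional ℂ (compressedKer K U l)] {c : ℝ} (hc : 0 < c)
    (hD : ∀ v ∈ U, v ∈ (compressedKer K U l)ᗮ →
      c * ‖v‖ ≤ ‖U.starProjection (pencil K l v)‖) :
    ∃ c' : ℝ, 0 < c' ∧ ∀ v ∈ U, v ∈ (commonKer K U l)ᗮ → c' * ‖v‖ ≤ ‖pencil K l v‖ := by
  set D := compressedKer K U l with hDdef
  set C := commonKer K U l
  have hfd : FiniteDimensional ℂ (D ⊓ Cᗮ : Submodule ℂ V) :=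
    Submodule.finiteDimensional_of_le inf_le_left
  obtain ⟨k, hk, hkb⟩ := exists_norm_le_of_finiteDimensional (D ⊓ Cᗮ) (pencil K l) (by
    rintro x ⟨hxD, hxC⟩ hx
    exact inner_self_eq_zero.1 (hxC x ⟨hxD.1, hx⟩))
  set a := ‖pencil K l‖
  have ha : 0 ≤ a := norm_nonneg _
  -- With `d` the projection of `v` to `D`, one has `‖v - d‖ ≤ ‖T v‖ / c` and `‖d‖ ≤ k ‖T d‖ ≤ k (‖T
  -- v‖ + a ‖v - d‖)`; `M` is the sum of the two coefficients.
  set M := k * (1 + a / c) + 1 / c with hM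
  have hMpos : 0 < M := by positivity
  refine ⟨M⁻¹, by positivity, fun v hvU hvC => ?_⟩
  rw [inv_mul_le_iff₀ hMpos]
  set d := D.starProjection v
  have hdD : d ∈ D := Submodule.starProjection_apply_mem _ _
  have hwD : v - d ∈ Dᗮ := Submodule.sub_starProjection_mem_orthogonal v
  have hdC : d ∈ Cᗮ := by
    intro e he
    have h1 := hwD e (commonKer_le_compressedKer hK U l he)
    rw [inner_sub_right, hvC e he, zero_sub, neg_eq_zero] at h1
    exact h1
  have h1 := hD (v - d) (U.sub_mem hvU hdD.1) hwD
  rw [map_sub, map_sub, starProjection_eq_zero_of_mem_weakKer hK hdD.2, sub_zero] at h1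
  have h2 : c * ‖v - d‖ ≤ ‖pencil K l v‖ := h1.trans (Submodule.norm_starProjection_apply_le _ _)
  have h2' : ‖v - d‖ ≤ ‖pencil K l v‖ / c := by rw [le_div_iff₀ hc]; linarith
  have h3 := hkb d ⟨hdD, hdC⟩
  have h4 : ‖pencil K l d‖ ≤ ‖pencil K l v‖ + a * ‖v - d‖ := by
    have : pencil K l d = pencil K l v - pencil K l (v - d) := by rw [map_sub]; abel
    rw [this]
    exact (norm_sub_le _ _).trans (by gcongr; exact (pencil K l).le_opNorm _)
  have h5 : ‖v‖ ≤ ‖d‖ + ‖v - d‖ := by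
    calc ‖v‖ = ‖d + (v - d)‖ := by congr 1; abel
      _ ≤ _ := norm_add_le _ _
  calc ‖v‖ ≤ k * (‖pencil K l v‖ + a * (‖pencil K l v‖ / c)) + ‖pencil K l v‖ / c := by
        refine h5.trans (add_le_add (h3.trans ?_) h2')
        gcongr
        exact h4.trans (by gcongr)
    _ = M * ‖pencil K l v‖ := by rw [hM]; ring

theorem exists_pencil_bound_near {K : V →L[ℂ] V} {U X : Submodule ℂ V} {l c : ℝ} (hc : 0 < c)
    (h : ∀ v ∈ U, v ∈ X → c * ‖v‖ ≤ ‖pencil K l v‖) :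
    ∃ δ : ℝ, 0 < δ ∧ ∀ μ : ℝ, |l - μ| < δ → ∀ v ∈ U, v ∈ X →
      c / 2 * ‖v‖ ≤ ‖pencil K μ v‖ := by
  have hk : 0 < ‖K‖ + 1 := by positivity
  refine ⟨c / 2 / (‖K‖ + 1), by positivity, fun μ hμ v hv hvX => ?_⟩
  rw [lt_div_iff₀ hk] at hμ
  have h1 := h v hv hvX
  have h2 := norm_ofReal_smul_apply_le K (l - μ) v
  have h3 : ‖pencil K l v‖ ≤ ‖pencil K μ v‖ + ‖((l - μ : ℝ) : ℂ) • K v‖ := by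
    rw [pencil_eq_add K μ l v]
    have := norm_sub_le (pencil K l v + ((l - μ : ℝ) : ℂ) • K v) (((l - μ : ℝ) : ℂ) • K v)
    rwa [add_sub_cancel_right] at this
  have h4 : |l - μ| * ‖K‖ * ‖v‖ ≤ c / 2 * ‖v‖ := by
    refine mul_le_mul_of_nonneg_right ?_ (norm_nonneg _)
    nlinarith [abs_nonneg (l - μ)]
  linarith

/-- Weak solutions for `μ` are close to weak solutions for `ν`. -/
theorem norm_sub_starProjection_weakKer_le [CompleteSpace V] {K : V →L[ℂ] V}
    (hK : K.toLinearMap.IsSymmetric) {U : Submodule ℂ V} {l μ ν c : ℝ}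
    [FiniteDimensional ℂ (commonKer K U l)] (hc : 0 < c)
    (hν : ∀ v ∈ U, v ∈ (commonKer K U l)ᗮ → c * ‖v‖ ≤ ‖pencil K ν v‖) {g : V}
    (hg : g ∈ weakKer K U μ) (hgC : g ∈ (commonKer K U l)ᗮ) :
    ‖g - (weakKer K U ν).starProjection g‖ ≤ |μ - ν| * ‖K‖ / c * ‖g‖ := by
  set κ := |μ - ν| * ‖K‖ / c with hκ
  set C := commonKer K U l
  have hκ0 : 0 ≤ κ := by positivity
  have h1 : ∀ v ∈ U, ‖inner ℂ (pencil K ν v) g‖ ≤ κ * ‖g‖ * ‖pencil K ν v‖ := by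
    intro v hv
    -- The `C`-part of `v` does not contribute, since the pencil preserves `C` and `g ⟂ C`. On the
    -- rest, replacing `ν` by `μ` costs `(μ - ν) K (v - e)`, and the `μ`-term is orthogonal to `g`.
    set e := C.starProjection v
    have heC : e ∈ C := Submodule.starProjection_apply_mem _ _
    have hwC : v - e ∈ Cᗮ := Submodule.sub_starProjection_mem_orthogonal v
    have hwU : v - e ∈ U := U.sub_mem hv heC.1
    have hTe := pencil_mem_commonKer heC ν
    have hTw := pencil_mem_commonKer_orthogonal hK hwC ν
    have hsum : pencil K ν v = pencil K ν e + pencil K ν (v - e) := by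
      rw [← map_add]; congr 1; abel
    have h2 : ‖pencil K ν (v - e)‖ ≤ ‖pencil K ν v‖ := by
      have := norm_add_sq_eq_norm_sq_add_norm_sq_of_inner_eq_zero (𝕜 := ℂ) _ _ (hTw _ hTe)
      rw [← hsum] at this
      refine le_of_sq_le_sq ?_ (norm_nonneg _)
      nlinarith [sq_nonneg ‖pencil K ν e‖]
    have h3 : inner ℂ (pencil K ν v) g = inner ℂ (((μ - ν : ℝ) : ℂ) • K (v - e)) g := by
      rw [hsum, inner_add_left, hgC _ hTe, zero_add, pencil_eq_add K ν μ, inner_add_left,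
        mem_weakKer.1 hg _ hwU, zero_add]
    rw [h3]
    have h4 : ‖v - e‖ ≤ ‖pencil K ν v‖ / c := by
      rw [le_div_iff₀ hc]; linarith [hν _ hwU hwC]
    calc ‖inner ℂ (((μ - ν : ℝ) : ℂ) • K (v - e)) g‖
        ≤ ‖((μ - ν : ℝ) : ℂ) • K (v - e)‖ * ‖g‖ := norm_inner_le_norm _ _
      _ ≤ (|μ - ν| * ‖K‖ * (‖pencil K ν v‖ / c)) * ‖g‖ := by
        gcongr
        exact (norm_ofReal_smul_apply_le K _ _).trans (by gcongr)
      _ = κ * ‖g‖ * ‖pencil K ν v‖ := by rw [hκ]; ring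
  have h2 : ∀ r ∈ (U.map (pencil K ν).toLinearMap).topologicalClosure,
      ‖inner ℂ r g‖ ≤ κ * ‖g‖ * ‖r‖ := by
    intro r hr
    have hcl : IsClosed {r : V | ‖inner ℂ r g‖ ≤ κ * ‖g‖ * ‖r‖} :=
      isClosed_le (by fun_prop) (by fun_prop)
    refine closure_minimal ?_ hcl hr
    rintro _ ⟨v, hv, rfl⟩
    exact h1 v hv
  set Q := (weakKer K U ν).starProjection
  -- The error `g - Q g` lies in the space where the functional estimate holds, and pairing it with
  -- `g` gives its own squared norm.
  have hr : g - Q g ∈ (U.map (pencil K ν).toLinearMap).topologicalClosure := by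
    rw [← Submodule.orthogonal_orthogonal_eq_closure]
    exact Submodule.sub_starProjection_mem_orthogonal g
  have h3 := h2 _ hr
  have h4 : inner ℂ (g - Q g) g = ((‖g - Q g‖ ^ 2 : ℝ) : ℂ) := by
    have h5 : inner ℂ (g - Q g) (Q g) = 0 :=
      Submodule.inner_left_of_mem_orthogonal (Submodule.starProjection_apply_mem _ g)
        (Submodule.sub_starProjection_mem_orthogonal g)
    have h6 : inner ℂ (g - Q g) g = inner ℂ (g - Q g) (g - Q g) := by
      rw [inner_sub_right (g - Q g) g (Q g), h5, sub_zero]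
    rw [h6, inner_self_eq_norm_sq_to_K]
    norm_cast
  rw [h4, Complex.norm_real, Real.norm_eq_abs, abs_of_nonneg (by positivity), sq] at h3
  rcases (norm_nonneg (g - Q g)).eq_or_lt with h | h
  · rw [← h]; positivity
  · exact le_of_mul_le_mul_right h3 h

/-- This is the identity `ker 𝓑_l = N + D` in quantitative form. With `h` the compressed image of
`u`, write `T u - h = T v`, `v ∈ U`. Then `T (u - v) = h` controls `u - v` modulo `N`, and the
`U`-projection of `T v` is that of `-h`, which controls `v` modulo `D`. So `u` is within `2‖h‖ / c`
of `N + D`, to which it is orthogonal. -/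
theorem exists_compression_bound [CompleteSpace V] {K : V →L[ℂ] V}
    (hK : K.toLinearMap.IsSymmetric) {U : Submodule ℂ V} (hU : IsClosed (U : Set V))
    [U.HasOrthogonalProjection] {l : ℝ} [FiniteDimensional ℂ (pencil K l).ker]
    [FiniteDimensional ℂ (compressedKer K U l)] {c : ℝ} (hc : 0 < c)
    (hN : ∀ v ∈ (pencil K l).kerᗮ, c * ‖v‖ ≤ ‖pencil K l v‖)
    (hD : ∀ v ∈ U, v ∈ (compressedKer K U l)ᗮ →
      c * ‖v‖ ≤ ‖U.starProjection (pencil K l v)‖) :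
    ∀ u ∈ weakKer K U l, u ∈ ((pencil K l).ker ⊔ compressedKer K U l)ᗮ →
      c / 2 * ‖u‖ ≤ ‖(weakKer K U l).starProjection (pencil K l u)‖ := by
  obtain ⟨c', hc', hC⟩ := exists_pencil_bound hK hc hD
  set N := (pencil K l).ker with hNdef
  set D := compressedKer K U l with hDdef
  set C := commonKer K U l with hCdef
  set T := pencil K l
  have hfdC : FiniteDimensional ℂ C :=
    Submodule.finiteDimensional_of_le (commonKer_le_compressedKer hK U l)
  -- `T` vanishes on `C`, so the image of `U` is that of `U ∩ Cᗮ`, where `T` is bounded below.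
  have hclosed : IsClosed ((U.map T.toLinearMap : Submodule ℂ V) : Set V) := by
    have hcl : IsClosed ((U ⊓ Cᗮ : Submodule ℂ V) : Set V) :=
      hU.inter (Submodule.isClosed_orthogonal _)
    have : CompleteSpace (U ⊓ Cᗮ : Submodule ℂ V) := hcl.completeSpace_coe
    have hanti : AntilipschitzWith (Real.toNNReal c')⁻¹
        (T ∘L (U ⊓ Cᗮ : Submodule ℂ V).subtypeL) := by
      refine ContinuousLinearMap.antilipschitz_of_bound _ fun u => ?_
      rw [NNReal.coe_inv, Real.coe_toNNReal _ hc'.le, ← div_eq_inv_mul, le_div_iff₀ hc', mul_comm]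
      exact hC u u.2.1 u.2.2
    convert hanti.isClosed_range (T ∘L (U ⊓ Cᗮ : Submodule ℂ V).subtypeL).uniformContinuous
      using 1
    ext y
    constructor
    · rintro ⟨v, hv, rfl⟩
      have heC : C.starProjection v ∈ C := Submodule.starProjection_apply_mem _ _
      refine ⟨⟨v - C.starProjection v, U.sub_mem hv heC.1,
        Submodule.sub_starProjection_mem_orthogonal v⟩, ?_⟩
      change T (v - C.starProjection v) = T v
      rw [map_sub, show T (C.starProjection v) = 0 from heC.2, sub_zero]
    · rintro ⟨v, rfl⟩
      exact ⟨v, v.2.1, rfl⟩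
  intro u hu huM
  set h := (weakKer K U l).starProjection (T u)
  have hmem : T u - h ∈ U.map T.toLinearMap := by
    have h1 : T u - h ∈ (weakKer K U l)ᗮ := Submodule.sub_starProjection_mem_orthogonal _
    rw [weakKer, Submodule.orthogonal_orthogonal_eq_closure,
      hclosed.submodule_topologicalClosure_eq] at h1
    exact h1
  obtain ⟨v, hvU, hv⟩ := hmem
  have hv' : T v = T u - h := hv
  have hT : T (u - v) = h := by rw [map_sub, hv']; abel
  set n := N.starProjection (u - v)
  have hn : n ∈ N := Submodule.starProjection_apply_mem _ _
  have hTn : T ((u - v) - n) = h := by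
    rw [map_sub T (u - v) n, show T n = 0 from hn, sub_zero, hT]
  have h1 := hN ((u - v) - n) (Submodule.sub_starProjection_mem_orthogonal (K := N) (u - v))
  rw [hTn] at h1
  set d := D.starProjection v
  have hd : d ∈ D := Submodule.starProjection_apply_mem _ _
  have h2 := hD _ (U.sub_mem hvU hd.1) (Submodule.sub_starProjection_mem_orthogonal (K := D) v)
  rw [map_sub, map_sub, show U.starProjection (T (D.starProjection v)) = 0 from
    starProjection_eq_zero_of_mem_weakKer hK hd.2, sub_zero, hv', map_sub,
    starProjection_eq_zero_of_mem_weakKer hK hu, zero_sub, norm_neg] at h2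
  have h2' := h2.trans (Submodule.norm_starProjection_apply_le U h)
  have hnd : n + d ∈ N ⊔ D := Submodule.add_mem_sup hn hd
  have h3 : ‖u‖ ≤ ‖u - (n + d)‖ := by
    have h4 : ‖u - (n + d)‖ * ‖u - (n + d)‖ = ‖u‖ * ‖u‖ + ‖n + d‖ * ‖n + d‖ := by
      rw [sub_eq_add_neg, norm_add_sq_eq_norm_sq_add_norm_sq_of_inner_eq_zero (𝕜 := ℂ), norm_neg]
      rw [inner_neg_right, neg_eq_zero]
      exact Submodule.inner_left_of_mem_orthogonal hnd huM
    exact abs_le_of_sq_le_sq' (by nlinarith [mul_self_nonneg ‖n + d‖]) (norm_nonneg _) |>.2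
  have h5 : ‖u - (n + d)‖ ≤ ‖(u - v) - n‖ + ‖v - d‖ := by
    have : u - (n + d) = ((u - v) - n) + (v - d) := by abel
    rw [this]; exact norm_add_le _ _
  have h6 : c * ‖u‖ ≤ c * ‖(u - v) - n‖ + c * ‖v - d‖ := by
    rw [← mul_add]; exact mul_le_mul_of_nonneg_left (h3.trans h5) hc.le
  have h8 : c * ‖v - d‖ ≤ ‖h‖ := h2'
  linarith

end Pencil

/-! ### Perturbation in `μ`: stability of the lower bound and first-order behaviour of test vectors.
-/

noncomputable section PencilPerturbation

variable {V : Type*} [NormedAddCommGroup V] [InnerProductSpace ℂ V]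

theorem le_of_sq_le_mul {x y : ℝ} (hx : 0 ≤ x) (hy : 0 ≤ y) (h : x ^ 2 ≤ y * x) : x ≤ y := by
  rcases hx.eq_or_lt with h0 | h0
  · rwa [← h0]
  · rw [sq] at h
    exact le_of_mul_le_mul_right h h0

theorem inner_starProjection_self (X : Submodule ℂ V) [X.HasOrthogonalProjection] (u : V) :
    inner ℂ u (X.starProjection u) = ((‖X.starProjection u‖ ^ 2 : ℝ) : ℂ) := by
  have h : X.starProjection (X.starProjection u) = X.starProjection u :=
    Submodule.starProjection_eq_self_iff.2 (Submodule.starProjection_apply_mem _ _)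
  calc inner ℂ u (X.starProjection u) = inner ℂ u (X.starProjection (X.starProjection u)) := by
        rw [h]
    _ = inner ℂ (X.starProjection u) (X.starProjection u) :=
        (Submodule.inner_starProjection_left_eq_right _ _ _).symm
    _ = _ := by rw [inner_self_eq_norm_sq_to_K]; norm_cast

theorem inner_starProjection_left_of_mem (X : Submodule ℂ V) [X.HasOrthogonalProjection]
    (u : V) {v : V} (hv : v ∈ X) : inner ℂ (X.starProjection u) v = inner ℂ u v := by
  rw [Submodule.inner_starProjection_left_eq_right, Submodule.starProjection_eq_self_iff.2 hv]

/-- The lower bound for the compression of the pencil persists for `μ` near `l`. -/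
theorem exists_compression_bound_near [CompleteSpace V] {K : V →L[ℂ] V}
    (hK : K.toLinearMap.IsSymmetric) {U : Submodule ℂ V} {l : ℝ}
    [FiniteDimensional ℂ (commonKer K U l)] {c r δ₀ : ℝ} (hc : 0 < c) (hr : 0 < r) (hδ₀ : 0 < δ₀)
    (hC : ∀ μ : ℝ, |l - μ| < δ₀ → ∀ v ∈ U, v ∈ (commonKer K U l)ᗮ →
      c * ‖v‖ ≤ ‖pencil K μ v‖)
    (hl : ∀ u ∈ weakKer K U l, u ∈ ((pencil K l).ker ⊔ compressedKer K U l)ᗮ →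
      r * ‖u‖ ≤ ‖(weakKer K U l).starProjection (pencil K l u)‖) :
    ∃ δ : ℝ, 0 < δ ∧ ∀ μ : ℝ, |l - μ| < δ → μ ≠ l →
      ∀ u ∈ weakKer K U μ, u ∈ ((pencil K l).ker ⊔ compressedKer K U l)ᗮ →
        r / 2 * ‖u‖ ≤ ‖(weakKer K U μ).starProjection (pencil K μ u)‖ := by
  set a := ‖pencil K l‖
  set k := ‖K‖
  have ha : 0 ≤ a := norm_nonneg _
  have hk : 0 ≤ k := norm_nonneg _
  -- `s * M` bounds the total loss for `s = |l - μ| < 1`: moving `h` to `G_μ`, replacing `T_l g` by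
  -- `T_μ u`, and replacing `u` by its projection `g`. The choice of `δ` keeps this below `r / 2`.
  set M := (2 * a + k) * k / c + k + r * k / c with hM
  have hM0 : 0 ≤ M := by positivity
  refine ⟨min δ₀ (min 1 (r / 2 / (M + 1))), by positivity, fun μ hμ hne u hu huM => ?_⟩
  obtain ⟨hμ0, hμ1, hμ2⟩ : |l - μ| < δ₀ ∧ |l - μ| < 1 ∧ |l - μ| < r / 2 / (M + 1) := by
    simpa [lt_min_iff] using hμ
  set s := |l - μ| with hs
  have hs0 : 0 ≤ s := abs_nonneg _
  have hs' : |μ - l| = s := by rw [hs, abs_sub_comm]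
  rw [lt_div_iff₀ (by positivity)] at hμ2
  set κ := s * k / c with hκ
  have hκ0 : 0 ≤ κ := by positivity
  set Q₀ := (weakKer K U l).starProjection
  set Q := (weakKer K U μ).starProjection
  have huC := weakKer_le_commonKer_orthogonal U hne hu
  set g := Q₀ u
  have hg : g ∈ weakKer K U l := Submodule.starProjection_apply_mem _ _
  have h1 : ‖u - g‖ ≤ κ * ‖u‖ := by
    have := norm_sub_starProjection_weakKer_le hK hc (hC l (by simpa using hδ₀)) hu huC
    rwa [hs'] at this
  have hNG : (pencil K l).ker ⊔ compressedKer K U l ≤ weakKer K U l :=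
    sup_le (ker_le_weakKer hK U l) inf_le_right
  have hgM : g ∈ ((pencil K l).ker ⊔ compressedKer K U l)ᗮ := by
    intro m hm
    have : inner ℂ (Q₀ m) u = inner ℂ m (Q₀ u) := Submodule.inner_starProjection_left_eq_right _ _ _
    rw [← this, Submodule.starProjection_eq_self_iff.2 (hNG hm)]
    exact huM m hm
  have h2 := hl g hg hgM
  set h := Q₀ (pencil K l g)
  have hh : h ∈ weakKer K U l := Submodule.starProjection_apply_mem _ _
  -- Weak solutions for `l` are approximated by those for `μ` only off `C`, so `h` must be shown to
  -- avoid `C`.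
  have hhC : h ∈ (commonKer K U l)ᗮ := by
    intro e he
    have heN : e ∈ (pencil K l).ker := he.2
    have h3 : inner ℂ (Q₀ e) (pencil K l g) = inner ℂ e (Q₀ (pencil K l g)) :=
      Submodule.inner_starProjection_left_eq_right _ _ _
    rw [← h3, Submodule.starProjection_eq_self_iff.2 (ker_le_weakKer hK U l heN),
      ← pencil_symm hK, show pencil K l e = 0 from heN, inner_zero_left]
  have h3 : ‖h - Q h‖ ≤ κ * ‖h‖ := norm_sub_starProjection_weakKer_le hK hc (hC μ hμ0) hh hhC
  have h4 : ((‖h‖ ^ 2 : ℝ) : ℂ) = inner ℂ (Q (pencil K μ u)) h +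
      inner ℂ (pencil K μ u) (h - Q h) + inner ℂ (pencil K l g - pencil K μ u) h := by
    have e1 : inner ℂ (pencil K l g) h = ((‖h‖ ^ 2 : ℝ) : ℂ) := inner_starProjection_self _ _
    have e2 : inner ℂ (Q (pencil K μ u)) h = inner ℂ (pencil K μ u) (Q h) :=
      Submodule.inner_starProjection_left_eq_right _ _ _
    rw [e2, inner_sub_left, e1, inner_sub_right]
    ring
  have h5 : ‖pencil K μ u‖ ≤ (a + s * k) * ‖u‖ := norm_pencil_apply_le K μ l u
  have h6 : ‖pencil K l g - pencil K μ u‖ ≤ (a * κ + s * k) * ‖u‖ := by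
    have e : pencil K l g - pencil K μ u =
        -(pencil K l (u - g) + ((l - μ : ℝ) : ℂ) • K u) := by
      rw [pencil_eq_add K μ l u, map_sub]; abel
    rw [e, norm_neg, add_mul]
    refine (norm_add_le _ _).trans (add_le_add ?_ (norm_ofReal_smul_apply_le K _ _))
    rw [mul_assoc]
    exact ((pencil K l).le_opNorm _).trans (by gcongr)
  set x := ‖Q (pencil K μ u)‖
  have h7 : ‖h‖ ^ 2 ≤ (x + ((a + s * k) * κ + (a * κ + s * k)) * ‖u‖) * ‖h‖ := by
    have e : ‖h‖ ^ 2 = ‖((‖h‖ ^ 2 : ℝ) : ℂ)‖ := by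
      rw [Complex.norm_real, Real.norm_of_nonneg (by positivity)]
    rw [e, h4]
    calc _ ≤ ‖Q (pencil K μ u)‖ * ‖h‖ + ‖pencil K μ u‖ * ‖h - Q h‖ +
          ‖pencil K l g - pencil K μ u‖ * ‖h‖ :=
          (norm_add₃_le).trans (add_le_add_three (norm_inner_le_norm _ _)
            (norm_inner_le_norm _ _) (norm_inner_le_norm _ _))
      _ ≤ x * ‖h‖ + (a + s * k) * ‖u‖ * (κ * ‖h‖) + (a * κ + s * k) * ‖u‖ * ‖h‖ := by gcongr
      _ = _ := by ring
  have h8 := le_of_sq_le_mul (norm_nonneg h) (by positivity) h7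
  have h9 : (1 - κ) * ‖u‖ ≤ ‖g‖ := by
    have : ‖u‖ ≤ ‖u - g‖ + ‖g‖ := by
      calc ‖u‖ = ‖(u - g) + g‖ := by congr 1; abel
        _ ≤ _ := norm_add_le _ _
    linarith
  have h10 : r * ((1 - κ) * ‖u‖) ≤ x + ((a + s * k) * κ + (a * κ + s * k)) * ‖u‖ :=
    (mul_le_mul_of_nonneg_left h9 hr.le).trans (h2.trans h8)
  have h11 : (a + s * k) * κ + (a * κ + s * k) + r * κ ≤ s * M := by
    have : (a + s * k) * κ ≤ (a + k) * κ := by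
      gcongr
      nlinarith
    have e : s * M = (a + k) * κ + (a * κ + s * k) + r * κ := by rw [hM, hκ]; ring
    linarith
  have h12 : s * M ≤ r / 2 := by nlinarith
  have h13 : ((a + s * k) * κ + (a * κ + s * k) + r * κ) * ‖u‖ ≤ r / 2 * ‖u‖ :=
    mul_le_mul_of_nonneg_right (h11.trans h12) (norm_nonneg _)
  nlinarith

/-- First-order expansion of the compressed form on the projections of kernel elements. -/
theorem exists_test_expansion [CompleteSpace V] {K : V →L[ℂ] V}
    (hK : K.toLinearMap.IsSymmetric) {U : Submodule ℂ V} {l : ℝ}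
    [FiniteDimensional ℂ (commonKer K U l)] {c δ₀ : ℝ} (hc : 0 < c) (hδ₀ : 0 < δ₀)
    (hC : ∀ μ : ℝ, |l - μ| < δ₀ → ∀ v ∈ U, v ∈ (commonKer K U l)ᗮ →
      c * ‖v‖ ≤ ‖pencil K μ v‖) :
    ∃ M : ℝ, 0 < M ∧ ∀ μ : ℝ, |l - μ| < δ₀ → |l - μ| < 1 → μ ≠ l →
      ∀ m ∈ weakKer K U l, m ∈ (commonKer K U l)ᗮ → ∀ u,
        u = (weakKer K U μ).starProjection m → ∀ b,
        b = (weakKer K U μ).starProjection (pencil K μ u) →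
        ((m ∈ (pencil K l).ker ∨ m ∈ U) → ‖b‖ ≤ M * |l - μ| * ‖m‖) ∧
        (m ∈ (pencil K l).ker → |(inner ℂ b u).re - (l - μ) * (inner ℂ (K m) m).re| ≤
          M * |l - μ| ^ 2 * ‖m‖ ^ 2) ∧
        (m ∈ U → |(inner ℂ b u).re + (l - μ) * (inner ℂ (K m) m).re| ≤
          M * |l - μ| ^ 2 * ‖m‖ ^ 2) := by
  set a := ‖pencil K l‖
  set k := ‖K‖
  have ha : 0 ≤ a := norm_nonneg _
  have hk : 0 ≤ k := norm_nonneg _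
  set M₁ := 2 * a * k / c + k with hM₁
  set M₂ := 2 * k ^ 2 / c + (a + k) * (k / c) ^ 2 with hM₂
  have hM₁0 : 0 ≤ M₁ := by positivity
  have hM₂0 : 0 ≤ M₂ := by positivity
  refine ⟨M₁ + M₂ + 1, by positivity, fun μ hμ hμ1 hne m hm hmC u hu b hb => ?_⟩
  set s := |l - μ| with hs
  have hs0 : 0 ≤ s := abs_nonneg _
  have hs' : |μ - l| = s := by rw [hs, abs_sub_comm]
  set κ := s * k / c with hκ
  have hκ0 : 0 ≤ κ := by positivity
  set Q₀ := (weakKer K U l).starProjection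
  set Q := (weakKer K U μ).starProjection
  have huG : u ∈ weakKer K U μ := hu ▸ Submodule.starProjection_apply_mem _ _
  have hbG : b ∈ weakKer K U μ := hb ▸ Submodule.starProjection_apply_mem _ _
  set w := u - m with hw
  have huw : u = m + w := by rw [hw]; abel
  have hwn : ‖w‖ ≤ κ * ‖m‖ := by
    have := norm_sub_starProjection_weakKer_le hK hc (hC μ hμ) hm hmC
    rwa [← hu, norm_sub_rev] at this
  have hun : ‖u‖ ≤ ‖m‖ := hu ▸ Submodule.norm_starProjection_apply_le _ _
  have hTw : |(inner ℂ (pencil K μ w) w).re| ≤ (a + k) * (k / c) ^ 2 * s ^ 2 * ‖m‖ ^ 2 := by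
    calc |(inner ℂ (pencil K μ w) w).re| ≤ ‖inner ℂ (pencil K μ w) w‖ := Complex.abs_re_le_norm _
      _ ≤ ‖pencil K μ w‖ * ‖w‖ := norm_inner_le_norm _ _
      _ ≤ (a + s * k) * ‖w‖ * ‖w‖ := by gcongr; exact norm_pencil_apply_le K μ l w
      _ ≤ (a + 1 * k) * (κ * ‖m‖) * (κ * ‖m‖) := by gcongr
      _ = _ := by rw [hκ]; ring
  have hbu : inner ℂ b u = inner ℂ (pencil K μ u) u := by
    rw [hb]; exact inner_starProjection_left_of_mem _ _ huG
  have hsmn : 0 ≤ s ^ 2 * ‖m‖ ^ 2 := by positivity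
  refine ⟨fun hmK => ?_, fun hmN => ?_, fun hmU => ?_⟩
  · have hbC := weakKer_le_commonKer_orthogonal U hne hbG
    have h1 : ‖b - Q₀ b‖ ≤ κ * ‖b‖ := by
      have := norm_sub_starProjection_weakKer_le hK hc (hC l (by simpa using hδ₀)) hbG hbC
      rwa [hs'] at this
    -- This removes the zeroth-order term: `T_l m` vanishes for `m ∈ N` and is orthogonal to `G_l`
    -- for `m ∈ U`.
    have h0 : inner ℂ (pencil K l m) (Q₀ b) = 0 := by
      rcases hmK with hmN | hmU
      · rw [show pencil K l m = 0 from hmN, inner_zero_left]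
      · exact mem_weakKer.1 (Submodule.starProjection_apply_mem _ b) m hmU
    have h2 : ((‖b‖ ^ 2 : ℝ) : ℂ) = inner ℂ (pencil K l m) (b - Q₀ b) +
        inner ℂ (pencil K l w) b + inner ℂ (((l - μ : ℝ) : ℂ) • K u) b := by
      have e1 : inner ℂ (pencil K μ u) b = ((‖b‖ ^ 2 : ℝ) : ℂ) := by
        rw [hb]; exact inner_starProjection_self _ _
      have e2 : pencil K l u = pencil K l m + pencil K l w := by rw [← map_add, ← huw]
      rw [← e1, pencil_eq_add K μ l u, inner_add_left, e2, inner_add_left, inner_sub_right, h0,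
        sub_zero]
    have h3 : ‖b‖ ^ 2 ≤ (M₁ * s * ‖m‖) * ‖b‖ := by
      have e : ‖b‖ ^ 2 = ‖((‖b‖ ^ 2 : ℝ) : ℂ)‖ := by
        rw [Complex.norm_real, Real.norm_of_nonneg (by positivity)]
      rw [e, h2]
      calc _ ≤ ‖pencil K l m‖ * ‖b - Q₀ b‖ + ‖pencil K l w‖ * ‖b‖ +
            ‖((l - μ : ℝ) : ℂ) • K u‖ * ‖b‖ :=
            (norm_add₃_le).trans (add_le_add_three (norm_inner_le_norm _ _)
              (norm_inner_le_norm _ _) (norm_inner_le_norm _ _))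
        _ ≤ (a * ‖m‖) * (κ * ‖b‖) + (a * (κ * ‖m‖)) * ‖b‖ + (s * k * ‖m‖) * ‖b‖ := by
          gcongr
          · exact (pencil K l).le_opNorm _
          · exact ((pencil K l).le_opNorm _).trans (by gcongr)
          · exact (norm_ofReal_smul_apply_le K _ _).trans (by gcongr)
        _ = _ := by rw [hM₁, hκ]; ring
    have h4 := le_of_sq_le_mul (norm_nonneg b) (by positivity) h3
    have h5 : 0 ≤ s * ‖m‖ := by positivity
    nlinarith
  -- For `m ∈ N` the image `T_μ m` is itself of first order, so its pairing with the first-order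
  -- correction `w` is of second order.
  · have hTm : pencil K μ m = ((l - μ : ℝ) : ℂ) • K m := by
      rw [pencil_eq_add K μ l m, show pencil K l m = 0 from hmN, zero_add]
    have h1 : (inner ℂ b u).re = (l - μ) * (inner ℂ (K m) m).re +
        2 * (inner ℂ (pencil K μ m) w).re + (inner ℂ (pencil K μ w) w).re := by
      have e1 : inner ℂ (pencil K μ w) m = inner ℂ w (pencil K μ m) := pencil_symm hK _ _ _
      have e2 : (inner ℂ w (pencil K μ m)).re = (inner ℂ (pencil K μ m) w).re :=
        inner_re_symm (𝕜 := ℂ) _ _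
      have e3 : (inner ℂ (pencil K μ m) m).re = (l - μ) * (inner ℂ (K m) m).re := by
        rw [hTm, inner_smul_left, Complex.conj_ofReal, Complex.re_ofReal_mul]
      rw [hbu, huw, map_add, inner_add_left, inner_add_right, inner_add_right, e1]
      simp only [Complex.add_re]
      rw [e2, e3]; ring
    have h2 : |(inner ℂ (pencil K μ m) w).re| ≤ k ^ 2 / c * s ^ 2 * ‖m‖ ^ 2 := by
      calc |(inner ℂ (pencil K μ m) w).re| ≤ ‖inner ℂ (pencil K μ m) w‖ :=
            Complex.abs_re_le_norm _
        _ ≤ ‖pencil K μ m‖ * ‖w‖ := norm_inner_le_norm _ _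
        _ ≤ (s * k * ‖m‖) * (κ * ‖m‖) := by
          gcongr
          rw [hTm]; exact norm_ofReal_smul_apply_le K _ _
        _ = _ := by rw [hκ]; ring
    have h3 : M₂ * (s ^ 2 * ‖m‖ ^ 2) = 2 * (k ^ 2 / c * s ^ 2 * ‖m‖ ^ 2) +
        (a + k) * (k / c) ^ 2 * s ^ 2 * ‖m‖ ^ 2 := by rw [hM₂]; ring
    have h4 : M₂ * (s ^ 2 * ‖m‖ ^ 2) ≤ (M₁ + M₂ + 1) * s ^ 2 * ‖m‖ ^ 2 := by nlinarith
    rw [abs_le] at h2 hTw ⊢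
    rw [h1]
    constructor <;> linarith [h2.1, h2.2, hTw.1, hTw.2]
  -- The sign flips here: `T_μ m ⟂ u` because `m ∈ U`, so the cross term equals minus the leading
  -- term, and it enters twice.
  · have h1 : (inner ℂ b u).re = -((l - μ) * (inner ℂ (K m) m).re) +
        (inner ℂ (pencil K μ w) w).re := by
      have e0 : inner ℂ (pencil K μ m) u = 0 := mem_weakKer.1 huG m hmU
      have e1 : inner ℂ (pencil K l m) m = 0 := mem_weakKer.1 hm m hmU
      have e2 : (inner ℂ (pencil K μ w) m).re = (inner ℂ (pencil K μ m) w).re := by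
        rw [pencil_symm hK]; exact inner_re_symm (𝕜 := ℂ) _ _
      have e3 : (inner ℂ (pencil K μ m) m).re = (l - μ) * (inner ℂ (K m) m).re := by
        rw [pencil_eq_add K μ l m, inner_add_left, e1, zero_add, inner_smul_left,
          Complex.conj_ofReal, Complex.re_ofReal_mul]
      have e4 : (inner ℂ (pencil K μ m) m).re + (inner ℂ (pencil K μ m) w).re = 0 := by
        rw [← Complex.add_re, ← inner_add_right, ← huw, e0, Complex.zero_re]
      rw [hbu, huw, map_add, inner_add_left, inner_add_right, inner_add_right]
      simp only [Complex.add_re]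
      rw [e2]; linarith
    have h4 : (a + k) * (k / c) ^ 2 * s ^ 2 * ‖m‖ ^ 2 ≤ (M₁ + M₂ + 1) * s ^ 2 * ‖m‖ ^ 2 := by
      have : (a + k) * (k / c) ^ 2 ≤ M₁ + M₂ + 1 := by
        have : 0 ≤ 2 * k ^ 2 / c := by positivity
        rw [hM₂]; linarith
      gcongr
    rw [h1]
    rw [show -((l - μ) * (inner ℂ (K m) m).re) + (inner ℂ (pencil K μ w) w).re +
      (l - μ) * (inner ℂ (K m) m).re = (inner ℂ (pencil K μ w) w).re by ring]
    exact hTw.trans h4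

/-- The quadratic expression `B (B ± ε)` is negative on the test vectors near `l`. -/
theorem exists_test_negative [CompleteSpace V] {K : V →L[ℂ] V}
    (hK : K.toLinearMap.IsSymmetric) (hpos : ∀ u, 0 ≤ (inner ℂ (K u) u).re)
    {U : Submodule ℂ V} {l : ℝ}
    [FiniteDimensional ℂ (commonKer K U l)] {c δ₀ : ℝ} (hc : 0 < c) (hδ₀ : 0 < δ₀)
    (hC : ∀ μ : ℝ, |l - μ| < δ₀ → ∀ v ∈ U, v ∈ (commonKer K U l)ᗮ →
      c * ‖v‖ ≤ ‖pencil K μ v‖) {ε : ℝ} (hε : 0 < ε) :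
    ∃ δ : ℝ, 0 < δ ∧ ∀ μ : ℝ, |l - μ| < δ → μ ≠ l →
      ∀ m ∈ (commonKer K U l)ᗮ, m ≠ 0 → ∀ u,
        u = (weakKer K U μ).starProjection m → ∀ b,
        b = (weakKer K U μ).starProjection (pencil K μ u) →
        (m ∈ (pencil K l).ker →
          |l - μ| * ‖b‖ ^ 2 - ε * ((l - μ) * (inner ℂ b u).re) < 0) ∧
        (m ∈ compressedKer K U l →
          |l - μ| * ‖b‖ ^ 2 + ε * ((l - μ) * (inner ℂ b u).re) < 0) := by
  obtain ⟨M, hM, h⟩ := exists_test_expansion hK hc hδ₀ hC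
  -- For `m` in `N` or `D`, `(T_l m, m) = 0` says `‖m‖² = l (Km, m)`, so `L (Km, m)` dominates
  -- `‖m‖²`.
  set L := |l| + 1 with hL
  have hL0 : 0 < L := by positivity
  set R := (M ^ 2 + ε * M) * L with hR
  have hR0 : 0 < R := by positivity
  refine ⟨min δ₀ (min 1 (ε / R)), by positivity, fun μ hμ hne m hmC hm0 u hu b hb => ?_⟩
  obtain ⟨hμ0, hμ1, hμ2⟩ : |l - μ| < δ₀ ∧ |l - μ| < 1 ∧ |l - μ| < ε / R := by
    simpa [lt_min_iff] using hμ
  rw [lt_div_iff₀ hR0] at hμ2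
  set s := |l - μ| with hs
  have hs0 : 0 < s := abs_pos.2 (sub_ne_zero.2 (Ne.symm hne))
  have hn : 0 < ‖m‖ := norm_pos_iff.2 hm0
  set q := (inner ℂ (K m) m).re with hq
  have hq0 : 0 ≤ q := hpos m
  have hmq : inner ℂ (pencil K l m) m = 0 → ‖m‖ ^ 2 ≤ L * q := by
    intro h0
    have h1 := congrArg Complex.re h0
    rw [pencil_apply, inner_sub_left, inner_smul_left, Complex.conj_ofReal, Complex.sub_re,
      Complex.re_ofReal_mul, Complex.zero_re] at h1
    have h2 : (inner ℂ m m).re = ‖m‖ ^ 2 := inner_self_eq_norm_sq (𝕜 := ℂ) m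
    have h3 : l * q ≤ |l| * q := mul_le_mul_of_nonneg_right (le_abs_self l) hq0
    rw [h2] at h1
    rw [hL]; linarith
  have hss : (l - μ) * (l - μ) = s * s := by rw [hs, abs_mul_abs_self]
  -- One estimate serves both cases, `y` being the form value for `m ∈ N` and its negative for `m ∈
  -- D`. The main term `ε s² q` beats errors of size `s³ (M² + ε M) ‖m‖²` once `s R < ε`. The factor
  -- `s` absorbs the sign of `l - μ`.
  have key : ∀ y : ℝ, ‖m‖ ^ 2 ≤ L * q → ‖b‖ ≤ M * s * ‖m‖ →
      |y - (l - μ) * q| ≤ M * s ^ 2 * ‖m‖ ^ 2 → s * ‖b‖ ^ 2 - ε * ((l - μ) * y) < 0 := by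
    intro y h1 h2 h3
    have h4 : ‖b‖ ^ 2 ≤ (M * s * ‖m‖) ^ 2 := by gcongr
    have h5 : (l - μ) * ((l - μ) * q - y) ≤ s * (M * s ^ 2 * ‖m‖ ^ 2) := by
      refine (le_abs_self _).trans ?_
      rw [abs_mul, abs_sub_comm ((l - μ) * q) y]
      gcongr
    have h6 : s * ‖b‖ ^ 2 ≤ s * (M * s * ‖m‖) ^ 2 := by gcongr
    have h7 : s * R * ‖m‖ ^ 2 < ε * ‖m‖ ^ 2 := by gcongr
    have h8 : s * R * ‖m‖ ^ 2 < ε * (L * q) := h7.trans_le (by gcongr)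
    have h9 : s * (M ^ 2 + ε * M) * ‖m‖ ^ 2 < ε * q := by
      have : L * (s * (M ^ 2 + ε * M) * ‖m‖ ^ 2) < L * (ε * q) := by
        calc _ = s * R * ‖m‖ ^ 2 := by rw [hR]; ring
          _ < _ := h8
          _ = _ := by ring
      exact lt_of_mul_lt_mul_left this hL0.le
    have h10 : s ^ 2 * (s * (M ^ 2 + ε * M) * ‖m‖ ^ 2) < s ^ 2 * (ε * q) := by gcongr
    have h11 : ε * ((l - μ) * ((l - μ) * q - y)) ≤ ε * (s * (M * s ^ 2 * ‖m‖ ^ 2)) := by gcongr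
    have h12 : ε * ((l - μ) * ((l - μ) * q - y)) = ε * (s * s * q) - ε * ((l - μ) * y) := by
      rw [← hss]; ring
    nlinarith
  constructor
  · intro hmN
    have hmG := ker_le_weakKer hK U l hmN
    obtain ⟨h1, h2, -⟩ := h μ hμ0 hμ1 hne m hmG hmC u hu b hb
    refine key _ (hmq ?_) (h1 (Or.inl hmN)) (h2 hmN)
    rw [show pencil K l m = 0 from hmN, inner_zero_left]
  · rintro ⟨hmU, hmG⟩
    obtain ⟨h1, -, h3⟩ := h μ hμ0 hμ1 hne m hmG hmC u hu b hb
    have h4 := key (-(inner ℂ b u).re) (hmq (mem_weakKer.1 hmG m hmU)) (h1 (Or.inr hmU)) (by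
      have := h3 hmU
      rw [← abs_neg] at this
      convert this using 2
      ring)
    linarith

end PencilPerturbation

/-! ### From operators generated by forms to bounds and kernels in `H¹`. -/

noncomputable section OperatorsOfForms

theorem starProjection_congr {V : Type*} [NormedAddCommGroup V] [InnerProductSpace ℂ V]
    {X Y : Submodule ℂ V} [X.HasOrthogonalProjection] [Y.HasOrthogonalProjection] (h : X = Y) :
    X.starProjection = Y.starProjection := by
  subst h; rfl

theorem exists_norm_le_of_isClosed_range {E F : Type*} [NormedAddCommGroup E]
    [InnerProductSpace ℂ E] [CompleteSpace E] [NormedAddCommGroup F] [NormedSpace ℂ F]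
    [CompleteSpace F] (R : E →L[ℂ] F) (hR : IsClosed (R.range : Set F)) :
    ∃ k : ℝ, 0 ≤ k ∧ ∀ x ∈ R.kerᗮ, ‖x‖ ≤ k * ‖R x‖ := by
  have hkc : CompleteSpace R.ker := R.isClosed_ker.completeSpace_coe
  have hkc' : CompleteSpace (R.kerᗮ : Submodule ℂ E) :=
    (Submodule.isClosed_orthogonal _).completeSpace_coe
  have hinj : Function.Injective (R ∘L (R.kerᗮ).subtypeL) := by
    refine (injective_iff_map_eq_zero _).2 fun x hx => ?_
    exact Subtype.ext (inner_self_eq_zero.1 (x.2 x hx))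
  have hran : Set.range (R ∘L (R.kerᗮ).subtypeL) = (R.range : Set F) := by
    ext y
    constructor
    · rintro ⟨x, rfl⟩
      exact ⟨x, rfl⟩
    · rintro ⟨x, rfl⟩
      have h0 : R (R.ker.starProjection x) = 0 := Submodule.starProjection_apply_mem R.ker x
      refine ⟨⟨x - R.ker.starProjection x, Submodule.sub_starProjection_mem_orthogonal x⟩, ?_⟩
      change R (x - R.ker.starProjection x) = R x
      rw [map_sub, h0, sub_zero]
  obtain ⟨k, hk⟩ := (R ∘L (R.kerᗮ).subtypeL).antilipschitz_of_injective_of_isClosed_range hinj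
    (hran ▸ hR)
  refine ⟨k, k.2, fun x hx => ?_⟩
  have := hk.le_mul_dist ⟨x, hx⟩ 0
  simpa [dist_zero_right] using this

/-- If `I - l j j*` has closed range, then `I - l j* j` is bounded below off its kernel. -/
theorem exists_pencil_adjoint_comp_bound {E F : Type*} [NormedAddCommGroup E]
    [InnerProductSpace ℂ E] [CompleteSpace E] [NormedAddCommGroup F] [InnerProductSpace ℂ F]
    [CompleteSpace F] (j : E →L[ℂ] F) (l : ℝ)
    (hR : IsClosed ((pencil (j ∘L ContinuousLinearMap.adjoint j) l).range : Set F)) :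
    ∃ c : ℝ, 0 < c ∧ ∀ u ∈ (pencil (ContinuousLinearMap.adjoint j ∘L j) l).kerᗮ,
      c * ‖u‖ ≤ ‖pencil (ContinuousLinearMap.adjoint j ∘L j) l u‖ := by
  set j' := ContinuousLinearMap.adjoint j
  set R := pencil (j ∘L j') l with hRdef
  set T := pencil (j' ∘L j) l with hTdef
  obtain ⟨k, hk, hkb⟩ := exists_norm_le_of_isClosed_range R hR
  -- The intertwining relations carry `(ker T)ᗮ` into `(ker R)ᗮ`, so `j u` is controlled by `T u`;
  -- then `u = T u + l j' j u` controls `u`.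
  have hRj : ∀ u, R (j u) = j (T u) := fun u => by simp [hRdef, hTdef, pencil_apply]
  have hTj : ∀ y, T (j' y) = j' (R y) := fun y => by simp [hRdef, hTdef, pencil_apply]
  set M := 1 + |l| * ‖j'‖ * (k * ‖j‖) with hM
  have hM0 : 0 < M := by positivity
  refine ⟨M⁻¹, by positivity, fun u hu => ?_⟩
  rw [inv_mul_le_iff₀ hM0]
  have h1 : ‖j u‖ ≤ k * (‖j‖ * ‖T u‖) := by
    have hju : j u ∈ R.kerᗮ := by
      intro y hy
      have : j' y ∈ T.ker := by
        change T (j' y) = 0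
        rw [hTj, show R y = 0 from hy, map_zero]
      rw [← ContinuousLinearMap.adjoint_inner_left]
      exact hu _ this
    refine (hkb _ hju).trans ?_
    rw [hRj]
    gcongr
    exact j.le_opNorm _
  have h2 : u = T u + (l : ℂ) • j' (j u) := by simp [hTdef, pencil_apply]
  calc ‖u‖ = ‖T u + (l : ℂ) • j' (j u)‖ := by rw [← h2]
    _ ≤ ‖T u‖ + |l| * (‖j'‖ * ‖j u‖) := by
      refine (norm_add_le _ _).trans ?_
      rw [norm_smul, Complex.norm_real, Real.norm_eq_abs]
      gcongr
      exact j'.le_opNorm _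
    _ ≤ ‖T u‖ + |l| * (‖j'‖ * (k * (‖j‖ * ‖T u‖))) := by gcongr
    _ = M * ‖T u‖ := by rw [hM]; ring

namespace ClosedPositiveForm

open PartialOp

variable {H : Type*} [NormedAddCommGroup H] [InnerProductSpace ℂ H]

/-- The bounded operator on `H¹` that represents the inner product of `H`. -/
def gram [CompleteSpace H] (a : ClosedPositiveForm H) : a.Space →L[ℂ] a.Space :=
  a.invN ∘L a.incl

theorem inner_gram_left [CompleteSpace H] (a : ClosedPositiveForm H) (u v : a.Space) :
    inner ℂ (a.gram u) v = inner ℂ (a.incl u) (a.incl v) := by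
  rw [gram, ContinuousLinearMap.comp_apply, invN]
  exact ContinuousLinearMap.adjoint_inner_left a.incl v (a.incl u)

theorem gram_symm [CompleteSpace H] (a : ClosedPositiveForm H) :
    a.gram.toLinearMap.IsSymmetric := by
  intro u v
  rw [ContinuousLinearMap.coe_coe, inner_gram_left, ← inner_conj_symm u, inner_gram_left,
    inner_conj_symm]

theorem gram_nonneg [CompleteSpace H] (a : ClosedPositiveForm H) (u : a.Space) :
    0 ≤ (inner ℂ (a.gram u) u).re := by
  rw [inner_gram_left]
  exact inner_self_nonneg (𝕜 := ℂ)

theorem mem_weakKer_gram [CompleteSpace H] (a : ClosedPositiveForm H)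
    (U : Submodule ℂ a.Space) (μ : ℝ) (u : a.Space) :
    u ∈ weakKer a.gram U μ ↔
      ∀ v ∈ U, inner ℂ ((μ : ℂ) • a.incl u) (a.incl v) = inner ℂ u v := by
  rw [mem_weakKer]
  refine forall₂_congr fun v _ => ?_
  rw [pencil_symm a.gram_symm, ← inner_conj_symm, map_eq_zero, pencil_apply, inner_sub_left,
    inner_smul_left, inner_gram_left, inner_smul_left, sub_eq_zero, eq_comm]

theorem mem_eigenspace_op (a : ClosedPositiveForm H) {U : Submodule ℂ a.Space}
    (hU : Dense (a.incl '' U)) (z : ℂ) (x : H) :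
    x ∈ eigenspace (a.op U U) z ↔
      ∃ u ∈ U, a.incl u = x ∧ ∀ v ∈ U, inner ℂ (z • x) (a.incl v) = inner ℂ u v := by
  rw [mem_eigenspace_iff, op_graph a hU]
  rfl

theorem eigenspace_op [CompleteSpace H] (a : ClosedPositiveForm H) {U : Submodule ℂ a.Space}
    (hU : Dense (a.incl '' U)) (μ : ℝ) :
    eigenspace (a.op U U) μ = (compressedKer a.gram U μ).map a.incl.toLinearMap := by
  ext x
  rw [mem_eigenspace_op a hU]
  constructor
  · rintro ⟨u, hu, rfl, h⟩
    exact ⟨u, ⟨hu, (a.mem_weakKer_gram U μ u).2 h⟩, rfl⟩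
  · rintro ⟨u, ⟨hu, h⟩, rfl⟩
    exact ⟨u, hu, rfl, (a.mem_weakKer_gram U μ u).1 h⟩

theorem inner_eq_zero_of_mem_eigenspace_op (a : ClosedPositiveForm H) {U : Submodule ℂ a.Space}
    (hU : Dense (a.incl '' U)) {z : ℂ} {l : ℝ} (hz : z ≠ l) {x y : H}
    (hx : x ∈ eigenspace (a.op U U) z) (hy : y ∈ eigenspace (a.op U U) l) :
    inner ℂ y x = 0 := by
  obtain ⟨u, hu, rfl, h⟩ := (a.mem_eigenspace_op hU z x).1 hx
  obtain ⟨v, hv, rfl, h'⟩ := (a.mem_eigenspace_op hU l y).1 hy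
  have h1 := congrArg (starRingEnd ℂ) (h v hv)
  have h2 := h' u hu
  rw [inner_conj_symm, inner_conj_symm, inner_smul_right, ← h2, inner_smul_left,
    Complex.conj_ofReal] at h1
  have h4 : (z - l) * inner ℂ (a.incl v) (a.incl u) = 0 := by
    linear_combination h1
  exact (mul_eq_zero.1 h4).resolve_left (sub_ne_zero.2 hz)

theorem finiteDimensional_compressedKer [CompleteSpace H] (a : ClosedPositiveForm H)
    {U : Submodule ℂ a.Space} (hU : Dense (a.incl '' U)) {l : ℝ}
    (hl : (l : ℂ) ∉ essSpectrum (a.op U U)) :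
    FiniteDimensional ℂ (compressedKer a.gram U l) := by
  have h1 : FiniteDimensional ℂ (LinearMap.ker (shift (a.op U U) l)) := by
    by_contra h
    exact hl fun h' => h h'.1
  have h2 : FiniteDimensional ℂ (eigenspace (a.op U U) l) := by
    unfold eigenspace; infer_instance
  rw [eigenspace_op a hU] at h2
  exact (Submodule.equivMapOfInjective a.incl.toLinearMap a.incl_injective
    _).symm.finiteDimensional

/-- The operator of the form on `U` has inverse `j j*`, with `j : U → H` the embedding, so applying
the operator minus `l` to `j j* f` gives `f - l j j* f`. -/
theorem range_shift_op [CompleteSpace H] (a : ClosedPositiveForm H)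
    {U : Submodule ℂ a.Space} [CompleteSpace U] (hU : Dense (a.incl '' U)) (l : ℝ) :
    LinearMap.range (shift (a.op U U) l) = (pencil ((a.incl ∘L U.subtypeL) ∘L
      ContinuousLinearMap.adjoint (a.incl ∘L U.subtypeL)) l).range := by
  set j := a.incl ∘L U.subtypeL with hj
  have hgraph : ∀ x f : H, (x, f) ∈ (a.op U U).graph ↔
      x = j (ContinuousLinearMap.adjoint j f) := by
    intro x f
    rw [op_graph a hU]
    constructor
    · rintro ⟨u, hu, rfl, h⟩
      have : (⟨u, hu⟩ : U) = ContinuousLinearMap.adjoint j f := by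
        refine ext_inner_right ℂ fun v => ?_
        rw [ContinuousLinearMap.adjoint_inner_left]
        exact (h v v.2).symm
      rw [← this]; rfl
    · rintro rfl
      refine ⟨ContinuousLinearMap.adjoint j f, Submodule.coe_mem _, rfl, fun v hv => ?_⟩
      exact (ContinuousLinearMap.adjoint_inner_left j (⟨v, hv⟩ : U) f).symm
  ext y
  constructor
  · rintro ⟨x, rfl⟩
    have h1 := (hgraph x (a.op U U x)).1 ((a.op U U).mem_graph x)
    refine ⟨a.op U U x, ?_⟩
    rw [ContinuousLinearMap.coe_coe, pencil_apply]
    change _ - (l : ℂ) • j (ContinuousLinearMap.adjoint j _) = _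
    rw [← h1]
    rfl
  · rintro ⟨f, rfl⟩
    obtain ⟨x, hx, hxf⟩ := (LinearPMap.mem_graph_iff _).1
      ((hgraph (j (ContinuousLinearMap.adjoint j f)) f).2 rfl)
    refine ⟨x, ?_⟩
    rw [ContinuousLinearMap.coe_coe, pencil_apply]
    change a.op U U x - (l : ℂ) • (x : H) = _
    rw [hx]
    congr 1

/-- Being outside the essential spectrum supplies a closed range for `I - l j j*` in `H`. This
passes to `I - l j* j`, which is the compression of the pencil to `U`. -/
theorem exists_compressed_bound [CompleteSpace H] (a : ClosedPositiveForm H)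
    {U : Submodule ℂ a.Space} [CompleteSpace U] (hU : Dense (a.incl '' U)) {l : ℝ}
    (hl : (l : ℂ) ∉ essSpectrum (a.op U U)) :
    ∃ c : ℝ, 0 < c ∧ ∀ v ∈ U, v ∈ (compressedKer a.gram U l)ᗮ →
      c * ‖v‖ ≤ ‖U.starProjection (pencil a.gram l v)‖ := by
  have hcl : IsClosed (LinearMap.range (shift (a.op U U) l) : Set H) := by
    by_contra h
    exact hl fun h' => h h'.2.1
  rw [range_shift_op a hU] at hcl
  obtain ⟨c, hc, h⟩ := exists_pencil_adjoint_comp_bound _ _ hcl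
  set j := a.incl ∘L U.subtypeL with hj
  have hT : ∀ v : U, ((pencil (ContinuousLinearMap.adjoint j ∘L j) l v : U) : a.Space) =
      U.starProjection (pencil a.gram l v) := by
    intro v
    have h1 : pencil (ContinuousLinearMap.adjoint j ∘L j) l v =
        U.orthogonalProjectionOnto (pencil a.gram l v) := by
      refine ext_inner_right ℂ fun w => ?_
      have h2 : inner ℂ (U.orthogonalProjectionOnto (pencil a.gram l v)) w =
          inner ℂ (pencil a.gram l (v : a.Space)) (w : a.Space) :=
        inner_starProjection_left_of_mem U _ w.2
      rw [h2, pencil_apply, pencil_apply, inner_sub_left, inner_sub_left, inner_smul_left,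
        inner_smul_left, inner_gram_left]
      congr 2
      exact ContinuousLinearMap.adjoint_inner_left j w (j v)
    rw [h1]; rfl
  refine ⟨c, hc, fun v hv hvD => ?_⟩
  rw [← hT ⟨v, hv⟩]
  refine h ⟨v, hv⟩ fun w hw => ?_
  refine hvD w ⟨w.2, mem_weakKer.2 fun x hx => ?_⟩
  have h3 : U.starProjection (pencil a.gram l w) = 0 := by
    rw [← hT w, show pencil (ContinuousLinearMap.adjoint j ∘L j) l w = 0 from hw]; rfl
  rw [Submodule.starProjection_apply_eq_zero_iff] at h3
  rw [pencil_symm a.gram_symm]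
  exact h3 x hx

theorem compressedKer_top [CompleteSpace H] (a : ClosedPositiveForm H) (l : ℝ) :
    compressedKer a.gram ⊤ l = (pencil a.gram l).ker := by
  refine le_antisymm ?_ (le_inf le_top (ker_le_weakKer a.gram_symm ⊤ l))
  rintro u ⟨-, hu⟩
  change pencil a.gram l u = 0
  rw [← inner_self_eq_zero (𝕜 := ℂ), ← pencil_symm a.gram_symm]
  exact mem_weakKer.1 hu _ trivial

end ClosedPositiveForm

/-! ### Multiplicities and the span of the common eigenvectors. -/

section ProjectedSpans

variable {H : Type*} [NormedAddCommGroup H] [InnerProductSpace ℂ H]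

/-- Intended for `E` an eigenspace, `C` its common part and `s` all common eigenvectors. The
right-hand side is closed because `C` is finite-dimensional, so taking the closure of the span adds
nothing to `E` beyond `C`. -/
theorem closure_span_le_sup_orthogonal {E C : Submodule ℂ H} [FiniteDimensional ℂ C] {s : Set H}
    (hs : ∀ u ∈ s, u ∈ C ∨ u ∈ Eᗮ) :
    (Submodule.span ℂ s).topologicalClosure ≤ Eᗮ ⊔ C := by
  refine Submodule.topologicalClosure_minimal _ (Submodule.span_le.2 fun u hu => ?_)
    (Submodule.isClosed_sup_finiteDimensional _ _ (Submodule.isClosed_orthogonal _))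
  rcases hs u hu with h | h
  · exact (le_sup_right : C ≤ Eᗮ ⊔ C) h
  · exact (le_sup_left : Eᗮ ≤ Eᗮ ⊔ C) h

theorem map_starProjection_closure_span {E C : Submodule ℂ H} [E.HasOrthogonalProjection]
    [FiniteDimensional ℂ C] (hCE : C ≤ E) {s : Set H} (hs : ∀ u ∈ s, u ∈ C ∨ u ∈ Eᗮ)
    (hCs : (C : Set H) ⊆ s) :
    (Submodule.span ℂ s).topologicalClosure.map E.starProjection.toLinearMap = C := by
  refine le_antisymm ?_ fun c hc => ⟨c, ?_, Submodule.starProjection_eq_self_iff.2 (hCE hc)⟩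
  · rintro _ ⟨x, hx, rfl⟩
    obtain ⟨e, he, c, hc, rfl⟩ := Submodule.mem_sup.1 (closure_span_le_sup_orthogonal hs hx)
    rw [map_add, ContinuousLinearMap.coe_coe, (Submodule.starProjection_apply_eq_zero_iff _).2 he,
      Submodule.starProjection_eq_self_iff.2 (hCE hc), zero_add]
    exact hc
  · exact Submodule.le_topologicalClosure _ (Submodule.subset_span (hCs hc))

theorem map_starProjection_closure_span_orthogonal {E C : Submodule ℂ H}
    [E.HasOrthogonalProjection] [FiniteDimensional ℂ C] (hCE : C ≤ E) {s : Set H}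
    (hs : ∀ u ∈ s, u ∈ C ∨ u ∈ Eᗮ) (hCs : (C : Set H) ⊆ s) :
    ((Submodule.span ℂ s).topologicalClosureᗮ).map E.starProjection.toLinearMap = Cᗮ ⊓ E := by
  refine le_antisymm ?_ fun y hy => ⟨y, ?_, Submodule.starProjection_eq_self_iff.2 hy.2⟩
  · rintro _ ⟨x, hx, rfl⟩
    refine ⟨fun c hc => ?_, Submodule.starProjection_apply_mem _ _⟩
    rw [ContinuousLinearMap.coe_coe, ← Submodule.inner_starProjection_left_eq_right,
      Submodule.starProjection_eq_self_iff.2 (hCE hc)]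
    exact hx c (Submodule.le_topologicalClosure _ (Submodule.subset_span (hCs hc)))
  · intro x hx
    obtain ⟨e, he, c, hc, rfl⟩ := Submodule.mem_sup.1 (closure_span_le_sup_orthogonal hs hx)
    rw [inner_add_left, hy.1 c hc, add_zero]
    exact Submodule.inner_left_of_mem_orthogonal hy.2 he

end ProjectedSpans

namespace FormPair

open PartialOp

variable {H : Type*} [NormedAddCommGroup H] [InnerProductSpace ℂ H]

theorem mem_common_or_orthogonal (P : FormPair H) (l : ℝ) {u : H} {z w : ℂ}
    (hN : u ∈ eigenspace P.AN z) (hD : u ∈ eigenspace P.AD w) :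
    u ∈ eigenspace P.AN l ⊓ eigenspace P.AD l ∨
      (u ∈ (eigenspace P.AN l)ᗮ ∧ u ∈ (eigenspace P.AD l)ᗮ) := by
  -- On `H₀¹` both sides represent the same functional `v ↦ a[u, v]`, and `H₀¹` is dense in `H`; so
  -- a common eigenvector has one common eigenvalue.
  have hzw : z • u = w • u := by
    obtain ⟨x, -, rfl, h⟩ := (P.a.mem_eigenspace_op P.a.dense_incl_top z u).1 hN
    obtain ⟨y, -, hy, h'⟩ := (P.a.mem_eigenspace_op P.dense_H₀ w _).1 hD
    obtain rfl := P.a.incl_injective hy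
    rw [← sub_eq_zero]
    refine P.dense_H₀.eq_zero_of_inner_left ℂ ?_
    rintro _ ⟨v, hv, rfl⟩
    rw [inner_sub_left, h v trivial, h' v hv, sub_self]
  rcases eq_or_ne u 0 with rfl | hu
  · exact Or.inl (Submodule.zero_mem _)
  have hzw' : z = w := smul_left_injective ℂ hu hzw
  subst hzw'
  by_cases hz : z = l
  · subst hz
    exact Or.inl ⟨hN, hD⟩
  · refine Or.inr ⟨fun y hy => ?_, fun y hy => ?_⟩
    · exact P.a.inner_eq_zero_of_mem_eigenspace_op P.a.dense_incl_top hz hN hy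
    · exact P.a.inner_eq_zero_of_mem_eigenspace_op P.dense_H₀ hz hD hy

theorem multiplicities [CompleteSpace H] (P : FormPair H) (l : ℝ)
    [FiniteDimensional ℂ (eigenspace P.AN l)] [FiniteDimensional ℂ (eigenspace P.AD l)] :
    P.nND l = Module.finrank ℂ
        (eigenspace P.AN l ⊓ eigenspace P.AD l : Submodule ℂ H) ∧
      P.nND l + P.nN l = Module.finrank ℂ (eigenspace P.AN l) ∧
      P.nND l + P.nD l = Module.finrank ℂ (eigenspace P.AD l) := by
  set EN := eigenspace P.AN l with hEN
  set ED := eigenspace P.AD l with hED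
  set C : Submodule ℂ H := EN ⊓ ED with hC
  have hfd : FiniteDimensional ℂ C := Submodule.finiteDimensional_of_le inf_le_left
  set s : Set H := {u | ∃ z w : ℂ, u ∈ eigenspace P.AN z ∧ u ∈ eigenspace P.AD w} with hs
  have hCs : (C : Set H) ⊆ s := fun u hu => ⟨l, l, hu.1, hu.2⟩
  have hsN : ∀ u ∈ s, u ∈ C ∨ u ∈ ENᗮ := by
    rintro u ⟨z, w, h1, h2⟩
    exact (P.mem_common_or_orthogonal l h1 h2).imp_right And.left
  have hsD : ∀ u ∈ s, u ∈ C ∨ u ∈ EDᗮ := by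
    rintro u ⟨z, w, h1, h2⟩
    exact (P.mem_common_or_orthogonal l h1 h2).imp_right And.right
  have hpN : eigenproj P.AN l = EN.starProjection :=
    starProjection_congr EN.closed_of_finiteDimensional.submodule_topologicalClosure_eq
  have hpD : eigenproj P.AD l = ED.starProjection :=
    starProjection_congr ED.closed_of_finiteDimensional.submodule_topologicalClosure_eq
  have h1 : P.nND l = Module.finrank ℂ C := by
    rw [nND, hpN, commonSpan, map_starProjection_closure_span inf_le_left hsN hCs]
  refine ⟨h1, ?_, ?_⟩
  · rw [h1, nN, hpN, commonSpan, map_starProjection_closure_span_orthogonal inf_le_left hsN hCs]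
    exact Submodule.finrank_add_inf_finrank_orthogonal inf_le_left
  · rw [h1, nD, hpD, commonSpan, map_starProjection_closure_span_orthogonal inf_le_right hsD hCs]
    exact Submodule.finrank_add_inf_finrank_orthogonal inf_le_right

end FormPair

end OperatorsOfForms

/-! ### The operators `𝓑_μ` and the final count. -/

section MainTheorem

namespace FormPair

open PartialOp

variable {H : Type*} [NormedAddCommGroup H] [InnerProductSpace ℂ H] [CompleteSpace H]

theorem G_eq_weakKer (P : FormPair H) (μ : ℝ) : P.G (μ : ℂ) = weakKer P.a.gram P.H₀ μ := by
  ext u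
  rw [mem_G_iff, P.a.mem_weakKer_gram]

theorem coe_B_apply (P : FormPair H) (μ : ℝ) (u : P.G (μ : ℂ)) :
    ((P.B μ u : P.G (μ : ℂ)) : P.a.Space) =
      (weakKer P.a.gram P.H₀ μ).starProjection (pencil P.a.gram μ u) := by
  rw [← starProjection_congr (P.G_eq_weakKer μ), pencil_apply, map_sub, map_smul,
    Submodule.starProjection_eq_self_iff.2 u.2]
  rfl

theorem isSelfAdjoint_B (P : FormPair H) (μ : ℝ) : IsSelfAdjoint (P.B μ) := by
  rw [ContinuousLinearMap.isSelfAdjoint_iff_isSymmetric]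
  have h : ∀ u v : P.G (μ : ℂ), inner ℂ (P.B μ u) v =
      inner ℂ (pencil P.a.gram μ (u : P.a.Space)) (v : P.a.Space) := by
    intro u v
    rw [Submodule.coe_inner, coe_B_apply]
    exact inner_starProjection_left_of_mem _ _ (P.G_eq_weakKer μ ▸ v.2)
  intro u v
  rw [ContinuousLinearMap.coe_coe, h, ← inner_conj_symm u, h,
    pencil_symm P.a.gram_symm, inner_conj_symm]

/-- `N` is killed by the pencil and `D` is mapped orthogonally to `G_l`, since `D ⊆ H₀¹`; the lower
bound `hb` excludes any further kernel. -/
theorem map_ker_B (P : FormPair H) {l r : ℝ} (hr : 0 < r)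
    [FiniteDimensional ℂ (pencil P.a.gram l).ker]
    [FiniteDimensional ℂ (compressedKer P.a.gram P.H₀ l)]
    (hb : ∀ u ∈ weakKer P.a.gram P.H₀ l,
      u ∈ ((pencil P.a.gram l).ker ⊔ compressedKer P.a.gram P.H₀ l)ᗮ →
      r * ‖u‖ ≤ ‖(weakKer P.a.gram P.H₀ l).starProjection (pencil P.a.gram l u)‖) :
    (P.B l).ker.map (P.G (l : ℂ)).subtype =
      (pencil P.a.gram l).ker ⊔ compressedKer P.a.gram P.H₀ l := by
  set N := (pencil P.a.gram l).ker
  set D := compressedKer P.a.gram P.H₀ l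
  set Q := (weakKer P.a.gram P.H₀ l).starProjection
  have hMG : N ⊔ D ≤ weakKer P.a.gram P.H₀ l :=
    sup_le (ker_le_weakKer P.a.gram_symm _ l) inf_le_right
  have hQ : ∀ u ∈ N ⊔ D, Q (pencil P.a.gram l u) = 0 := by
    intro u hu
    obtain ⟨n, hn, d, hd, rfl⟩ := Submodule.mem_sup.1 hu
    rw [map_add, show pencil P.a.gram l n = 0 from hn, zero_add,
      Submodule.starProjection_apply_eq_zero_iff]
    intro g hg
    rw [← inner_conj_symm, mem_weakKer.1 hg d hd.1, map_zero]
  ext u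
  constructor
  · rintro ⟨u, hu, rfl⟩
    have hu0 : Q (pencil P.a.gram l u) = 0 := by
      rw [← coe_B_apply, show P.B l u = 0 from hu]; rfl
    have huG : (u : P.a.Space) ∈ weakKer P.a.gram P.H₀ l := P.G_eq_weakKer l ▸ u.2
    set m := (N ⊔ D).starProjection (u : P.a.Space)
    have hm : m ∈ N ⊔ D := Submodule.starProjection_apply_mem _ _
    have h1 := hb (u - m) (Submodule.sub_mem _ huG (hMG hm))
      (Submodule.sub_starProjection_mem_orthogonal _)
    rw [map_sub, map_sub, show Q (pencil P.a.gram l u) = 0 from hu0, hQ m hm, sub_zero,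
      norm_zero] at h1
    have h2 : ‖(u : P.a.Space) - m‖ = 0 :=
      le_antisymm (nonpos_of_mul_nonpos_right h1 hr) (norm_nonneg _)
    rw [norm_eq_zero, sub_eq_zero] at h2
    rw [Submodule.subtype_apply, h2]
    exact hm
  · intro hu
    refine ⟨⟨u, P.G_eq_weakKer l ▸ hMG hu⟩, ?_, rfl⟩
    refine Subtype.ext ?_
    exact (P.coe_B_apply l _).trans (hQ u hu)

theorem spectrum_B_at (P : FormPair H) {l r ε : ℝ} (hε : 0 < ε) (hεr : ε < r)
    [FiniteDimensional ℂ (pencil P.a.gram l).ker]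
    [FiniteDimensional ℂ (compressedKer P.a.gram P.H₀ l)]
    (hb : ∀ u ∈ weakKer P.a.gram P.H₀ l,
      u ∈ ((pencil P.a.gram l).ker ⊔ compressedKer P.a.gram P.H₀ l)ᗮ →
      r * ‖u‖ ≤ ‖(weakKer P.a.gram P.H₀ l).starProjection (pencil P.a.gram l u)‖) :
    realSpectrum (P.B l) ∩ Set.Ioo (-ε) ε ⊆ {0} ∧
      SpectrumConsistsOf (P.B l) (Set.Ioo (-ε) ε) (Module.finrank ℂ
        ((pencil P.a.gram l).ker ⊔ compressedKer P.a.gram P.H₀ l : Submodule ℂ P.a.Space)) := by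
  have hmap := P.map_ker_B (hε.trans hεr) hb
  have hfd : FiniteDimensional ℂ
      ((pencil P.a.gram l).ker ⊔ compressedKer P.a.gram P.H₀ l : Submodule ℂ P.a.Space) :=
    inferInstance
  generalize (pencil P.a.gram l).ker ⊔ compressedKer P.a.gram P.H₀ l = M at *
  have hdim : Module.finrank ℂ (P.B l).ker = Module.finrank ℂ M := by
    rw [← hmap]
    exact (Submodule.equivMapOfInjective (P.G (l : ℂ)).subtype
      (P.G (l : ℂ)).injective_subtype (P.B l).ker).finrank_eq
  rw [← hdim]
  refine spectrumConsistsOf_kernel (P.isSelfAdjoint_B l)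
    (φ := M.orthogonalProjectionOnto ∘L (P.G (l : ℂ)).subtypeL) hε hεr (fun u hu => ?_)
    (fun u hu => ?_)
  · have huG : (u : P.a.Space) ∈ weakKer P.a.gram P.H₀ l := P.G_eq_weakKer l ▸ u.2
    have := hb u huG (Submodule.orthogonalProjectionOnto_eq_zero_iff.1 hu)
    rwa [← P.coe_B_apply] at this
  · change M.orthogonalProjectionOnto (u : P.a.Space) = 0
    rw [Submodule.orthogonalProjectionOnto_eq_zero_iff]
    intro m hm
    rw [← hmap] at hm
    obtain ⟨w, hw, rfl⟩ := hm
    exact hu w hw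

/-- Count of the eigenvalues of `𝓑_μ` near zero in terms of subspaces of `H¹`. -/
theorem spectrum_B_near (P : FormPair H) {μ r ε : ℝ} (hε : 0 < ε) (hεr : ε < r)
    {W X₁ X₂ : Submodule ℂ P.a.Space} [FiniteDimensional ℂ W]
    (hW : Module.finrank ℂ W ≤ Module.finrank ℂ X₁ + Module.finrank ℂ X₂)
    (hb : ∀ u ∈ weakKer P.a.gram P.H₀ μ, u ∈ Wᗮ →
      r * ‖u‖ ≤ ‖(weakKer P.a.gram P.H₀ μ).starProjection (pencil P.a.gram μ u)‖)
    (h₁ : ∀ m ∈ X₁, m ≠ 0 → ∀ u, u = (weakKer P.a.gram P.H₀ μ).starProjection m → ∀ b,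
      b = (weakKer P.a.gram P.H₀ μ).starProjection (pencil P.a.gram μ u) →
      ‖b‖ ^ 2 + ε * (inner ℂ b u).re < 0)
    (h₂ : ∀ m ∈ X₂, m ≠ 0 → ∀ u, u = (weakKer P.a.gram P.H₀ μ).starProjection m → ∀ b,
      b = (weakKer P.a.gram P.H₀ μ).starProjection (pencil P.a.gram μ u) →
      ‖b‖ ^ 2 - ε * (inner ℂ b u).re < 0) :
    SpectrumConsistsOf (P.B μ) (Set.Ioo (-ε) 0) (Module.finrank ℂ X₁) ∧
      0 ∉ realSpectrum (P.B μ) ∧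
      SpectrumConsistsOf (P.B μ) (Set.Ioo 0 ε) (Module.finrank ℂ X₂) := by
  have hpt : ∀ m : P.a.Space,
      (((P.G (μ : ℂ)).orthogonalProjectionOnto m : P.G (μ : ℂ)) : P.a.Space) =
        (weakKer P.a.gram P.H₀ μ).starProjection m := by
    intro m
    rw [← starProjection_congr (P.G_eq_weakKer μ)]
    rfl
  refine spectrumConsistsOf_of_test_spaces (P.isSelfAdjoint_B μ)
    (φ := W.orthogonalProjectionOnto ∘L (P.G (μ : ℂ)).subtypeL) hε hεr (fun u hu => ?_) hW
    ((P.G (μ : ℂ)).orthogonalProjectionOnto.toLinearMap ∘ₗ X₁.subtype) (fun x hx => ?_)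
    ((P.G (μ : ℂ)).orthogonalProjectionOnto.toLinearMap ∘ₗ X₂.subtype) (fun x hx => ?_)
  · have huG : (u : P.a.Space) ∈ weakKer P.a.gram P.H₀ μ := P.G_eq_weakKer μ ▸ u.2
    have := hb u huG (Submodule.orthogonalProjectionOnto_eq_zero_iff.1 hu)
    rwa [← P.coe_B_apply] at this
  · exact h₁ x x.2 (fun h => hx (Subtype.ext h)) _ (hpt x) _ (P.coe_B_apply μ _)
  · exact h₂ x x.2 (fun h => hx (Subtype.ext h)) _ (hpt x) _ (P.coe_B_apply μ _)

end FormPair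

end MainTheorem

theorem mainTheorem2 {H : Type*} [NormedAddCommGroup H] [InnerProductSpace ℂ H]
    [CompleteSpace H] [TopologicalSpace.SeparableSpace H] (hH : ¬ FiniteDimensional ℂ H)
    (P : FormPair H) (l : ℝ)
    (hl : (l : ℂ) ∉ PartialOp.essSpectrum P.AN ∪ PartialOp.essSpectrum P.AD) :
    ∃ ε₀ : ℝ, 0 < ε₀ ∧ ∀ ε : ℝ, 0 < ε → ε < ε₀ → ∃ δ : ℝ, 0 < δ ∧
      (realSpectrum (P.B l) ∩ Set.Ioo (-ε) ε ⊆ {0} ∧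
        SpectrumConsistsOf (P.B l) (Set.Ioo (-ε) ε) (P.nN l + P.nD l + P.nND l)) ∧
      (∀ μ ∈ Set.Ioo (l - δ) l,
        SpectrumConsistsOf (P.B μ) (Set.Ioo (-ε) 0) (P.nD l) ∧
        0 ∉ realSpectrum (P.B μ) ∧
        SpectrumConsistsOf (P.B μ) (Set.Ioo 0 ε) (P.nN l)) ∧
      (∀ μ ∈ Set.Ioo l (l + δ),
        SpectrumConsistsOf (P.B μ) (Set.Ioo (-ε) 0) (P.nN l) ∧
        0 ∉ realSpectrum (P.B μ) ∧
        SpectrumConsistsOf (P.B μ) (Set.Ioo 0 ε) (P.nD l)) := by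
  have hlN : (l : ℂ) ∉ PartialOp.essSpectrum (P.a.op ⊤ ⊤) := fun h => hl (Or.inl h)
  have hlD : (l : ℂ) ∉ PartialOp.essSpectrum (P.a.op P.H₀ P.H₀) := fun h => hl (Or.inr h)
  have hK := P.a.gram_symm
  have hcomp : CompleteSpace P.H₀ := P.isClosed_H₀.completeSpace_coe
  have hcompT : CompleteSpace (⊤ : Submodule ℂ P.a.Space) :=
    isClosed_univ.completeSpace_coe
  have hfdN := P.a.finiteDimensional_compressedKer P.a.dense_incl_top hlN
  have hfdD := P.a.finiteDimensional_compressedKer P.dense_H₀ hlD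
  obtain ⟨c₁, hc₁, hN⟩ := P.a.exists_compressed_bound P.a.dense_incl_top hlN
  obtain ⟨c₂, hc₂, hD⟩ := P.a.exists_compressed_bound P.dense_H₀ hlD
  have hEN : PartialOp.eigenspace P.AN l = _ := P.a.eigenspace_op P.a.dense_incl_top l
  have hED : PartialOp.eigenspace P.AD l = _ := P.a.eigenspace_op P.dense_H₀ l
  -- `A_N` is the case `U = ⊤`, where no compression takes place.
  rw [P.a.compressedKer_top] at hfdN hN hEN
  set K := P.a.gram
  set N := (pencil K l).ker with hNdef
  set D := compressedKer K P.H₀ l with hDdef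
  set C := commonKer K P.H₀ l with hCdef
  have hCND : C = N ⊓ D := commonKer_eq_inf hK _ l
  have hfdC : FiniteDimensional ℂ C :=
    Submodule.finiteDimensional_of_le (commonKer_le_compressedKer hK P.H₀ l)
  -- multiplicities as dimensions in `H¹`
  have hfin : ∀ X : Submodule ℂ P.a.Space,
      Module.finrank ℂ (X.map P.a.incl.toLinearMap) = Module.finrank ℂ X := fun X =>
    (Submodule.equivMapOfInjective P.a.incl.toLinearMap P.a.incl_injective X).finrank_eq.symm
  have hfdEN : FiniteDimensional ℂ (PartialOp.eigenspace P.AN l) := by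
    rw [hEN]; infer_instance
  have hfdED : FiniteDimensional ℂ (PartialOp.eigenspace P.AD l) := by
    rw [hED]; infer_instance
  obtain ⟨m₁, m₂, m₃⟩ := P.multiplicities l
  rw [hEN, hED, ← Submodule.map_inf _ P.a.incl_injective, hfin, ← hCND] at m₁
  rw [hEN, hfin] at m₂
  rw [hED, hfin] at m₃
  have d₁ : Module.finrank ℂ C + Module.finrank ℂ (Cᗮ ⊓ N : Submodule ℂ P.a.Space) =
      Module.finrank ℂ N :=
    Submodule.finrank_add_inf_finrank_orthogonal (hCND ▸ inf_le_left)
  have d₂ : Module.finrank ℂ C + Module.finrank ℂ (Cᗮ ⊓ D : Submodule ℂ P.a.Space) =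
      Module.finrank ℂ D :=
    Submodule.finrank_add_inf_finrank_orthogonal (hCND ▸ inf_le_right)
  have hCM : C ≤ N ⊔ D := (hCND ▸ inf_le_left : C ≤ N).trans le_sup_left
  have d₃ : Module.finrank ℂ C + Module.finrank ℂ (Cᗮ ⊓ (N ⊔ D) : Submodule ℂ P.a.Space) =
      Module.finrank ℂ (N ⊔ D : Submodule ℂ P.a.Space) :=
    Submodule.finrank_add_inf_finrank_orthogonal hCM
  have d₄ := Submodule.finrank_sup_add_finrank_inf_eq N D
  rw [← hCND] at d₄
  have hnN : Module.finrank ℂ (Cᗮ ⊓ N : Submodule ℂ P.a.Space) = P.nN l := by omega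
  have hnD : Module.finrank ℂ (Cᗮ ⊓ D : Submodule ℂ P.a.Space) = P.nD l := by omega
  -- lower bounds
  set c := min c₁ c₂ with hc
  have hc0 : 0 < c := lt_min hc₁ hc₂
  have hN' : ∀ v ∈ Nᗮ, c * ‖v‖ ≤ ‖pencil K l v‖ := by
    intro v hv
    have := hN v trivial hv
    rw [Submodule.starProjection_eq_self_iff.2 Submodule.mem_top] at this
    exact (mul_le_mul_of_nonneg_right (min_le_left _ _) (norm_nonneg _)).trans this
  have hD' : ∀ v ∈ P.H₀, v ∈ Dᗮ → c * ‖v‖ ≤ ‖P.H₀.starProjection (pencil K l v)‖ :=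
    fun v hv hvD => (mul_le_mul_of_nonneg_right (min_le_right _ _) (norm_nonneg _)).trans
      (hD v hv hvD)
  obtain ⟨c', hc', hC₀⟩ := exists_pencil_bound hK hc0 hD'
  obtain ⟨δ₀, hδ₀, hC⟩ := exists_pencil_bound_near hc' hC₀
  have hB₀ := exists_compression_bound hK P.isClosed_H₀ hc0 hN' hD'
  obtain ⟨δ₁, hδ₁, hB⟩ := exists_compression_bound_near hK (half_pos hc') (half_pos hc0) hδ₀ hC hB₀
  -- One factor `1/2` comes from the bound at `l`, the other from its persistence for nearby `μ`.
  -- This is the threshold `ε₀`; only `δ₂` depends on `ε`.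
  have hr : 0 < c / 2 / 2 := by positivity
  refine ⟨c / 2 / 2, hr, fun ε hε hε₀ => ?_⟩
  obtain ⟨δ₂, hδ₂, htest⟩ :=
    exists_test_negative hK P.a.gram_nonneg (half_pos hc') hδ₀ hC hε
  have hMfd : FiniteDimensional ℂ (Cᗮ ⊓ (N ⊔ D) : Submodule ℂ P.a.Space) :=
    Submodule.finiteDimensional_of_le inf_le_right
  have hWM : N ⊔ D ≤ C ⊔ (Cᗮ ⊓ (N ⊔ D)) := by
    intro x hx
    have h1 : C.starProjection x ∈ C := Submodule.starProjection_apply_mem _ _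
    refine Submodule.mem_sup.2 ⟨C.starProjection x, h1, x - C.starProjection x,
      ⟨Submodule.sub_starProjection_mem_orthogonal _, Submodule.sub_mem _ hx (hCM h1)⟩, by abel⟩
  -- Orthogonality to `C` is automatic on `G_μ`, which lowers the number of conditions from `dim (N
  -- + D)` to `n_N + n_D`.
  have hbound : ∀ μ : ℝ, |l - μ| < δ₁ → μ ≠ l → ∀ u ∈ weakKer K P.H₀ μ,
      u ∈ (Cᗮ ⊓ (N ⊔ D))ᗮ →
      c / 2 / 2 * ‖u‖ ≤ ‖(weakKer K P.H₀ μ).starProjection (pencil K μ u)‖ := by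
    intro μ hμ hne u huG huW
    refine hB μ hμ hne u huG (Submodule.orthogonal_le hWM ?_)
    rw [← Submodule.inf_orthogonal]
    exact ⟨weakKer_le_commonKer_orthogonal P.H₀ hne huG, huW⟩
  have hspec₀ := P.spectrum_B_at hε (by linarith) hB₀
  have hMdim : Module.finrank ℂ (N ⊔ D : Submodule ℂ P.a.Space) =
      P.nN l + P.nD l + P.nND l := by omega
  have hWdim : Module.finrank ℂ (Cᗮ ⊓ (N ⊔ D) : Submodule ℂ P.a.Space) = P.nN l + P.nD l := by
    omega
  refine ⟨min δ₁ δ₂, lt_min hδ₁ hδ₂, hMdim ▸ hspec₀, fun μ hμ => ?_, fun μ hμ => ?_⟩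
  · have hs : 0 < l - μ := by linarith [hμ.2]
    have habs : |l - μ| = l - μ := abs_of_pos hs
    have hlt : |l - μ| < min δ₁ δ₂ := by rw [habs]; linarith [hμ.1]
    rw [← hnN, ← hnD]
    refine P.spectrum_B_near hε hε₀ (by rw [hWdim, hnN, hnD, add_comm])
      (hbound μ (hlt.trans_le (min_le_left _ _)) hμ.2.ne)
      (fun m hm hm0 u hu b hb => ?_) (fun m hm hm0 u hu b hb => ?_)
    -- For `μ < l` the factor `l - μ` is positive and divides out: `D` gives the negative
    -- eigenvalues, `N` the positive ones. Above `l` the roles are exchanged.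
    · have h := (htest μ (hlt.trans_le (min_le_right _ _)) hμ.2.ne m hm.1 hm0 u hu b hb).2 hm.2
      rw [habs] at h
      exact neg_of_mul_neg_right (a := l - μ) (by linarith) hs.le
    · have h := (htest μ (hlt.trans_le (min_le_right _ _)) hμ.2.ne m hm.1 hm0 u hu b hb).1 hm.2
      rw [habs] at h
      exact neg_of_mul_neg_right (a := l - μ) (by linarith) hs.le
  · have hs : 0 < μ - l := by linarith [hμ.1]
    have habs : |l - μ| = μ - l := by rw [abs_sub_comm]; exact abs_of_pos hs
    have hlt : |l - μ| < min δ₁ δ₂ := by rw [habs]; linarith [hμ.2]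
    rw [← hnN, ← hnD]
    refine P.spectrum_B_near hε hε₀ (by rw [hWdim, hnN, hnD])
      (hbound μ (hlt.trans_le (min_le_left _ _)) hμ.1.ne')
      (fun m hm hm0 u hu b hb => ?_) (fun m hm hm0 u hu b hb => ?_)
    · have h := (htest μ (hlt.trans_le (min_le_right _ _)) hμ.1.ne' m hm.1 hm0 u hu b hb).1 hm.2
      rw [habs] at h
      exact neg_of_mul_neg_right (a := μ - l) (by linarith) hs.le
    · have h := (htest μ (hlt.trans_le (min_le_right _ _)) hμ.1.ne' m hm.1 hm0 u hu b hb).2 hm.2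
      rw [habs] at h
      exact neg_of_mul_neg_right (a := μ - l) (by linarith) hs.le
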